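/- Let $e\neq 0$ and $m=e/\sqrt{\pi}$, and let $\omega(k)=\sqrt{k^2+m^2}$. On the symmetric Fock space over $L^2(\mathbb{R},dk)$, with vacuum $\Omega$ and creation and annihilation operators $a^*(h),a(h)$, let $$\pi(g)=\tfrac{i}{\sqrt 2}\bigl(a^*(\omega^{1/2}\hat g)-a(\omega^{1/2}\hat g)\bigr),\qquad \hat g(k)=(2\pi)^{-1/2}\int e^{-ikx}g(x)\,dx,$$ for real Schwartz functions $g$, be the time-zero momentum (essentially self-adjoint on the finite-particle vectors, and identified with its closure) of the free scalar field $\phi$ of mass $m$ by which the Schwinger model is described, and let $H=\frac12\int{:}\pi^2+(\nabla\phi)^2+m^2\phi^2{:}\,dx$ be its Hamiltonian, i.e. the operator that multiplies the $n$-particle component by $\omega(k_1)+\dots+\omega(k_n)$. Given $\varepsilon>0$, let $g_{R,\varepsilon}$, $R>0$, be any real Schwartz functions with $g_{R,\varepsilon}=1$ on $[0,R]$ and $g_{R,\varepsilon}(x)=0$ for $x\le-\varepsilon$ and for $x\ge R+\varepsilon$, and define the dipole states $\Psi_{R,\varepsilon}=\exp[i\sqrt{\pi}\,\pi(g_{R,\varepsilon})]\,\Omega$.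 The family is said to have finite energy if every $\Psi_{R,\varepsilon}$ ($R>0$) lies in the quadratic form domain of $H$ and $\limsup_{R\to\infty}\langle\Psi_{R,\varepsilon},H\Psi_{R,\varepsilon}\rangle<\infty$. The fermions are called confined if every $\Psi_{R,\varepsilon}$ lies in the quadratic form domain of $H$ but the family does not have finite energy, i.e. $\limsup_{R\to\infty}\langle\Psi_{R,\varepsilon},H\Psi_{R,\varepsilon}\rangle=\infty$. Then there is a constant $c>0$, depending only on $e$, such that for every $\varepsilon>0$ and every such choice of functions $g_{R,\varepsilon}$: every $\Psi_{R,\varepsilon}$ with $R>0$ lies in the quadratic form domain of $H$, and $\langle\Psi_{R,\varepsilon},H\Psi_{R,\varepsilon}\rangle\ge cR$. Consequently $\limsup_{R\to\infty}\langle\Psi_{R,\varepsilon},H\Psi_{R,\varepsilon}\rangle=\infty$, and the fermions are confined. -/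

import Mathlib

open MeasureTheory
open scoped ENNReal SchwartzMap FourierTransform

noncomputable section

namespace Schwinger

/-! ### The symmetric Fock space over `L²(ℝ, dk)` (momentum space) -/

/-- Square integrable functions of `n` momenta. -/
abbrev L2n (n : ℕ) : Type := Lp ℂ 2 (volume : Measure (Fin n → ℝ))

theorem measurePreserving_perm {n : ℕ} (σ : Equiv.Perm (Fin n)) :
    MeasurePreserving (fun k : Fin n → ℝ => k ∘ σ) volume volume := by
  have h := volume_measurePreserving_piCongrLeft (fun _ : Fin n => ℝ) σ.symm
  have e : (fun k : Fin n → ℝ => k ∘ σ) =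
      MeasurableEquiv.piCongrLeft (fun _ : Fin n => ℝ) σ.symm := by
    funext k i
    have := Equiv.piCongrLeft_apply_apply (fun _ : Fin n => ℝ) σ.symm k (σ i)
    simpa [MeasurableEquiv.coe_piCongrLeft] using this.symm
  rw [e]
  exact h

/-- The bosonic `n`-particle space: square integrable functions of `n` momenta that are invariant
under every permutation of their arguments. -/
def nParticle (n : ℕ) : Submodule ℂ (L2n n) where
  carrier := {f | ∀ σ : Equiv.Perm (Fin n),
    Lp.compMeasurePreserving (fun k : Fin n → ℝ => k ∘ σ) (measurePreserving_perm σ) f = f}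
  add_mem' := by
    intro f g hf hg σ
    rw [map_add, hf σ, hg σ]
  zero_mem' := fun σ => map_zero _
  smul_mem' := by
    intro c f hf σ
    have := (Lp.compMeasurePreservingₗ ℂ (fun k : Fin n → ℝ => k ∘ σ)
      (measurePreserving_perm σ) (E := ℂ) (p := 2)).map_smul c f
    exact this.trans (congrArg (c • ·) (hf σ))

theorem isClosed_nParticle (n : ℕ) : IsClosed (nParticle n : Set (L2n n)) := by
  have : (nParticle n : Set (L2n n)) = ⋂ σ : Equiv.Perm (Fin n),
      {f | Lp.compMeasurePreserving (fun k : Fin n → ℝ => k ∘ σ)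
        (measurePreserving_perm σ) f = f} := by
    ext f
    rw [Set.mem_iInter]
    rfl
  rw [this]
  exact isClosed_iInter fun σ =>
    isClosed_eq (Lp.isometry_compMeasurePreserving _).continuous continuous_id

instance (n : ℕ) : CompleteSpace (nParticle n) :=
  (isClosed_nParticle n).completeSpace_coe

/-- The symmetric Fock space: the Hilbert sum of the bosonic `n`-particle spaces. -/
abbrev FockSpace : Type := lp (fun n : ℕ => nParticle n) 2

/-- The Fock vacuum `Ω = (1, 0, 0, …)`. -/
def vacuum : FockSpace :=
  lp.single 2 0 ⟨Lp.const 2 volume 1, fun σ => by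
    have : (fun k : Fin 0 → ℝ => k ∘ σ) = id := by
      funext k; exact Subsingleton.elim _ _
    simp only [this]
    exact Lp.compMeasurePreserving_id_apply _⟩

/-! ### Creation and annihilation operators -/

/-- The function `(k₀, …, kₙ) ↦ h(k₀) f(k₁, …, kₙ)`. -/
def tensorFun {n : ℕ} (h : Lp ℂ 2 (volume : Measure ℝ)) (f : L2n n) : (Fin (n + 1) → ℝ) → ℂ :=
  fun k => h (k 0) * f (Fin.tail k)

theorem measurePreserving_split (n : ℕ) :
    MeasurePreserving (fun k : Fin (n + 1) → ℝ => (k 0, Fin.tail k))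
      volume ((volume : Measure ℝ).prod (volume : Measure (Fin n → ℝ))) :=
  volume_preserving_piFinSuccAbove (fun _ : Fin (n + 1) => ℝ) 0

theorem memLp_prod {α β : Type} [MeasurableSpace α] [MeasurableSpace β] {μ : Measure α}
    {ν : Measure β} [SFinite μ] [SFinite ν] {h : α → ℂ} {f : β → ℂ}
    (hh : MemLp h 2 μ) (hf : MemLp f 2 ν) :
    MemLp (fun z : α × β => h z.1 * f z.2) 2 (μ.prod ν) := by
  have hm : AEStronglyMeasurable (fun z : α × β => h z.1 * f z.2) (μ.prod ν) :=
    hh.1.comp_fst.mul hf.1.comp_snd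
  rw [memLp_two_iff_integrable_sq_norm hm]
  have := ((memLp_two_iff_integrable_sq_norm hh.1).1 hh).mul_prod
    ((memLp_two_iff_integrable_sq_norm hf.1).1 hf)
  simpa [mul_pow] using this

theorem memLp_tensorFun {n : ℕ} (h : Lp ℂ 2 (volume : Measure ℝ)) (f : L2n n) :
    MemLp (tensorFun h f) 2 volume :=
  (memLp_prod (Lp.memLp h) (Lp.memLp f)).comp_measurePreserving (measurePreserving_split n)

theorem norm_sq_eq {α : Type} [MeasurableSpace α] {μ : Measure α} {F : α → ℂ}
    (hF : MemLp F 2 μ) : (eLpNorm F 2 μ).toReal ^ 2 = ∫ a, ‖F a‖ ^ 2 ∂μ := by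
  rw [← Lp.norm_toLp F hF]
  have h := L2.inner_def (𝕜 := ℂ) (hF.toLp F) (hF.toLp F)
  rw [inner_self_eq_norm_sq_to_K] at h
  have h2 : ∫ a, inner ℂ (hF.toLp F a) (hF.toLp F a) ∂μ = ((∫ a, ‖F a‖ ^ 2 ∂μ : ℝ) : ℂ) := by
    rw [← integral_complex_ofReal]
    refine integral_congr_ae ?_
    filter_upwards [hF.coeFn_toLp] with a ha
    rw [ha, inner_self_eq_norm_sq_to_K]
    simp
  rw [h2] at h
  exact Complex.ofReal_injective (by rw [← h]; simp)

theorem norm_prod {α β : Type} [MeasurableSpace α] [MeasurableSpace β] {μ : Measure α}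
    {ν : Measure β} [SFinite μ] [SFinite ν] {h : α → ℂ} {f : β → ℂ}
    (hh : MemLp h 2 μ) (hf : MemLp f 2 ν) :
    (eLpNorm (fun z : α × β => h z.1 * f z.2) 2 (μ.prod ν)).toReal =
      (eLpNorm h 2 μ).toReal * (eLpNorm f 2 ν).toReal := by
  refine (sq_eq_sq₀ ENNReal.toReal_nonneg
    (mul_nonneg ENNReal.toReal_nonneg ENNReal.toReal_nonneg)).1 ?_
  rw [mul_pow, norm_sq_eq hh, norm_sq_eq hf, norm_sq_eq (memLp_prod hh hf), ← integral_prod_mul]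
  simp [mul_pow]

theorem norm_tensor {n : ℕ} (h : Lp ℂ 2 (volume : Measure ℝ)) (f : L2n n) :
    ‖(memLp_tensorFun h f).toLp (tensorFun h f)‖ = ‖h‖ * ‖f‖ := by
  have key : ∀ G : ℝ × (Fin n → ℝ) → ℂ,
      MemLp G 2 ((volume : Measure ℝ).prod (volume : Measure (Fin n → ℝ))) →
      eLpNorm (fun k : Fin (n + 1) → ℝ => G (k 0, Fin.tail k)) 2 volume =
        eLpNorm G 2 ((volume : Measure ℝ).prod (volume : Measure (Fin n → ℝ))) :=
    fun G hG => eLpNorm_comp_measurePreserving hG.1 (measurePreserving_split n)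
  rw [Lp.norm_toLp, Lp.norm_def, Lp.norm_def, ← norm_prod (Lp.memLp h) (Lp.memLp f),
    ← key _ (memLp_prod (Lp.memLp h) (Lp.memLp f))]
  rfl

/-- `f ↦ h ⊗ f`, as a bounded operator. -/
def tensorLeft (n : ℕ) (h : Lp ℂ 2 (volume : Measure ℝ)) : L2n n →L[ℂ] L2n (n + 1) :=
  LinearMap.mkContinuous
    { toFun := fun f => (memLp_tensorFun h f).toLp (tensorFun h f)
      map_add' := by
        intro f g
        rw [← MemLp.toLp_add, MemLp.toLp_eq_toLp_iff]
        have := ((measurePreserving_split n).quasiMeasurePreserving.ae_eq_comp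
          ((Measure.quasiMeasurePreserving_snd (μ := (volume : Measure ℝ))).ae_eq_comp
            (Lp.coeFn_add f g)))
        filter_upwards [this] with k hk
        simp only [Function.comp_apply, Pi.add_apply] at hk
        simp only [tensorFun, hk, Pi.add_apply, mul_add]
      map_smul' := by
        intro c f
        rw [RingHom.id_apply, ← MemLp.toLp_const_smul, MemLp.toLp_eq_toLp_iff]
        have := ((measurePreserving_split n).quasiMeasurePreserving.ae_eq_comp
          ((Measure.quasiMeasurePreserving_snd (μ := (volume : Measure ℝ))).ae_eq_comp
            (Lp.coeFn_smul c f)))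
        filter_upwards [this] with k hk
        simp only [Function.comp_apply, Pi.smul_apply] at hk
        simp only [tensorFun, hk, Pi.smul_apply, smul_eq_mul]
        ring }
    ‖h‖ (fun f => (norm_tensor h f).le)

/-- The creation operator `a*(h)` from the `n`-particle to the `(n+1)`-particle space:
`a*(h) f = √(n+1) S (h ⊗ f)`, where the symmetrization `S` is the orthogonal projection onto
the permutation invariant functions. -/
def creationN (n : ℕ) (h : Lp ℂ 2 (volume : Measure ℝ)) : nParticle n →L[ℂ] nParticle (n + 1) :=
  ((Real.sqrt (n + 1) : ℝ) : ℂ) •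
    ((nParticle (n + 1)).orthogonalProjectionOnto ∘L tensorLeft n h ∘L (nParticle n).subtypeL)

/-- The annihilation operator `a(h)` from the `(n+1)`-particle to the `n`-particle space: the
adjoint of the creation operator. -/
def annihilationN (n : ℕ) (h : Lp ℂ 2 (volume : Measure ℝ)) :
    nParticle (n + 1) →L[ℂ] nParticle n :=
  ContinuousLinearMap.adjoint (creationN n h)

/-- The dense subspace of finite-particle vectors. -/
def finiteParticle : Submodule ℂ FockSpace where
  carrier := {ψ | ∃ N : ℕ, ∀ n, N ≤ n → ψ n = 0}
  add_mem' := by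
    rintro ψ φ ⟨N, hN⟩ ⟨M, hM⟩
    refine ⟨max N M, fun n hn => ?_⟩
    rw [lp.coeFn_add, Pi.add_apply, hN n (le_of_max_le_left hn), hM n (le_of_max_le_right hn),
      add_zero]
  zero_mem' := ⟨0, fun n _ => rfl⟩
  smul_mem' := by
    rintro c ψ ⟨N, hN⟩
    refine ⟨N, fun n hn => ?_⟩
    rw [lp.coeFn_smul, Pi.smul_apply, hN n hn, smul_zero]

/-- The components of `a*(h) ψ`. -/
def creationFun (h : Lp ℂ 2 (volume : Measure ℝ)) (ψ : FockSpace) : (n : ℕ) → nParticle n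
  | 0 => 0
  | n + 1 => creationN n h (ψ n)

/-- The components of `a(h) ψ`. -/
def annihilationFun (h : Lp ℂ 2 (volume : Measure ℝ)) (ψ : FockSpace) (n : ℕ) : nParticle n :=
  annihilationN n h (ψ (n + 1))

theorem memℓp_of_eventually_zero {u : (n : ℕ) → nParticle n} (hu : ∃ N : ℕ, ∀ n, N ≤ n → u n = 0) :
    Memℓp u 2 := by
  obtain ⟨N, hN⟩ := hu
  refine Memℓp.of_exponent_ge (memℓp_zero ?_) (zero_le)
  refine (Set.finite_lt_nat N).subset fun n hn => ?_
  by_contra hc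
  exact hn (hN n (not_lt.1 hc))

theorem creationFun_eventually_zero (h : Lp ℂ 2 (volume : Measure ℝ)) (ψ : finiteParticle) :
    ∃ N : ℕ, ∀ n, N ≤ n → creationFun h ψ n = 0 := by
  obtain ⟨N, hN⟩ := ψ.2
  refine ⟨N + 1, fun n hn => ?_⟩
  obtain ⟨m, rfl⟩ : ∃ m, n = m + 1 := ⟨n - 1, by omega⟩
  rw [creationFun, hN m (by omega), map_zero]

theorem annihilationFun_eventually_zero (h : Lp ℂ 2 (volume : Measure ℝ)) (ψ : finiteParticle) :
    ∃ N : ℕ, ∀ n, N ≤ n → annihilationFun h ψ n = 0 := by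
  obtain ⟨N, hN⟩ := ψ.2
  refine ⟨N, fun n hn => ?_⟩
  rw [annihilationFun, hN (n + 1) (by omega), map_zero]

/-- The creation operator `a*(h)` on finite-particle vectors. -/
def creation (h : Lp ℂ 2 (volume : Measure ℝ)) : finiteParticle →ₗ[ℂ] FockSpace where
  toFun ψ := ⟨creationFun h ψ, memℓp_of_eventually_zero (creationFun_eventually_zero h ψ)⟩
  map_add' ψ φ := by
    ext1; funext n
    cases n with
    | zero => exact (add_zero _).symm
    | succ n => exact map_add (creationN n h) ((ψ : FockSpace) n) ((φ : FockSpace) n)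
  map_smul' c ψ := by
    ext1; funext n
    cases n with
    | zero => exact (smul_zero c).symm
    | succ n => exact map_smul (creationN n h) c ((ψ : FockSpace) n)

/-- The annihilation operator `a(h)` on finite-particle vectors. -/
def annihilation (h : Lp ℂ 2 (volume : Measure ℝ)) : finiteParticle →ₗ[ℂ] FockSpace where
  toFun ψ := ⟨annihilationFun h ψ, memℓp_of_eventually_zero (annihilationFun_eventually_zero h ψ)⟩
  map_add' ψ φ := by
    ext1; funext n
    exact map_add (annihilationN n h) ((ψ : FockSpace) (n + 1)) ((φ : FockSpace) (n + 1))
  map_smul' c ψ := by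
    ext1; funext n
    exact map_smul (annihilationN n h) c ((ψ : FockSpace) (n + 1))

/-! ### The free field of mass `m` at time zero -/

/-- The one-particle energy `ω(k) = √(k² + m²)`. -/
def omega (m k : ℝ) : ℝ := Real.sqrt (k ^ 2 + m ^ 2)

/-- The function `k ↦ ω(k)^{1/2} ĝ(k)`, with the unitary Fourier transform
`ĝ(k) = (2π)^{-1/2} ∫ e^{-ikx} g(x) dx`. -/
def momentumFun (m : ℝ) (g : 𝓢(ℝ, ℝ)) (k : ℝ) : ℂ :=
  (Real.sqrt (omega m k) : ℂ) *
    ((Real.sqrt (2 * Real.pi) : ℂ)⁻¹ * ∫ x : ℝ, Complex.exp (-(Complex.I * k * x)) * (g x : ℂ))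

theorem memLp_momentumFun (m : ℝ) (g : 𝓢(ℝ, ℝ)) : MemLp (momentumFun m g) 2 volume := by
  let s : 𝓢(ℝ, ℂ) := 𝓕 (g.postcompCLM Complex.ofRealCLM)
  let L : ℝ ≃L[ℝ] ℝ :=
    ContinuousLinearEquiv.unitsEquivAut ℝ (Units.mk0 (2 * Real.pi)⁻¹ (by positivity))
  let s' : 𝓢(ℝ, ℂ) := SchwartzMap.compCLMOfContinuousLinearEquiv ℂ L s
  have hs : ∀ k : ℝ, ∫ x : ℝ, Complex.exp (-(Complex.I * k * x)) * (g x : ℂ) = s' k := by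
    intro k
    have h1 : s' k = s (k * (2 * Real.pi)⁻¹) := rfl
    rw [h1, SchwartzMap.fourier_coe, Real.fourier_eq']
    refine integral_congr_ae (Filter.Eventually.of_forall fun x => ?_)
    have hpi : (Real.pi : ℂ) ≠ 0 := by exact_mod_cast Real.pi_ne_zero
    have e : ((-2 * Real.pi * inner ℝ x (k * (2 * Real.pi)⁻¹) : ℝ) : ℂ) * Complex.I =
        -(Complex.I * k * x) := by
      simp only [RCLike.inner_apply, conj_trivial]
      push_cast
      field_simp
    simp only [smul_eq_mul]
    rw [e]
    rfl
  have hq : Function.HasTemperateGrowth (fun k : ℝ => 3 + |m| + k ^ 2) := by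
    fun_prop
  let q : 𝓢(ℝ, ℂ) := SchwartzMap.smulLeftCLM ℂ (fun k : ℝ => 3 + |m| + k ^ 2) s'
  have hfun : momentumFun m g = fun k => (Real.sqrt (omega m k) : ℂ) *
      ((Real.sqrt (2 * Real.pi) : ℂ)⁻¹ * s' k) := by
    funext k
    rw [momentumFun, hs]
  rw [hfun]
  refine MemLp.of_le (g := fun k => (Real.sqrt (2 * Real.pi) : ℂ)⁻¹ * q k)
    ((q.memLp 2 volume).const_mul _) ?_ (Filter.Eventually.of_forall fun k => ?_)
  · have h1 : Continuous (fun k => (Real.sqrt (omega m k) : ℂ)) := by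
      unfold omega; fun_prop
    exact (h1.mul (continuous_const.mul s'.continuous)).aestronglyMeasurable
  · have hq' : q k = (3 + |m| + k ^ 2 : ℝ) • s' k := SchwartzMap.smulLeftCLM_apply_apply hq s' k
    rw [hq', norm_mul, norm_mul, norm_mul, norm_smul, Complex.norm_real, Real.norm_eq_abs,
      abs_of_nonneg (Real.sqrt_nonneg _), Real.norm_eq_abs, abs_of_nonneg (by positivity)]
    have hb : Real.sqrt (omega m k) ≤ 3 + |m| + k ^ 2 := by
      have h0 : 0 ≤ omega m k := Real.sqrt_nonneg _
      have h1 : omega m k ≤ |m| + |k| := by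
        rw [omega]
        refine Real.sqrt_le_iff.2 ⟨by positivity, ?_⟩
        nlinarith [sq_abs m, sq_abs k, abs_nonneg m, abs_nonneg k,
          mul_nonneg (abs_nonneg m) (abs_nonneg k)]
      have h2 : |k| ≤ 1 + k ^ 2 := by nlinarith [sq_abs k, sq_nonneg (|k| - 1), abs_nonneg k]
      have h3 : Real.sqrt (omega m k) ≤ 1 + omega m k :=
        Real.sqrt_le_iff.2 ⟨by positivity, by nlinarith⟩
      linarith
    calc _ ≤ (3 + |m| + k ^ 2) * (‖(Real.sqrt (2 * Real.pi) : ℂ)⁻¹‖ * ‖s' k‖) := by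
          gcongr
      _ = _ := by ring

/-- The field momentum `π(g)` at time zero, conjugate to
`φ(f) = 2^{-1/2} (a*(ω^{-1/2} f̂) + a(ω^{-1/2} f̂))`:
`π(g) = i 2^{-1/2} (a*(ω^{1/2} ĝ) - a(ω^{1/2} ĝ))` on the finite-particle vectors, on which it is
essentially self-adjoint. -/
def fieldMomentum (m : ℝ) (g : 𝓢(ℝ, ℝ)) : FockSpace →ₗ.[ℂ] FockSpace where
  domain := finiteParticle
  toFun := (Complex.I * (Real.sqrt 2 : ℂ)⁻¹) •
    (creation ((memLp_momentumFun m g).toLp _) - annihilation ((memLp_momentumFun m g).toLp _))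

/-- `U` is a strongly continuous one-parameter unitary group whose generator extends `A`, i.e.
`U t = exp (i t A)`. For an essentially self-adjoint `A` there is exactly one such `U`, and its
generator is the closure of `A`. -/
structure IsUnitaryGroupOf {H : Type} [NormedAddCommGroup H] [InnerProductSpace ℂ H]
    (A : H →ₗ.[ℂ] H) (U : ℝ → H ≃ₗᵢ[ℂ] H) : Prop where
  add_apply : ∀ (s t : ℝ) (ψ : H), U (s + t) ψ = U s (U t ψ)
  continuous : ∀ ψ : H, Continuous fun t => U t ψ
  hasDerivAt : ∀ ψ : A.domain, HasDerivAt (fun t => U t (ψ : H)) (Complex.I • A ψ) 0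

open Classical in
/-- The unitary group `t ↦ exp (i t A)` of an essentially self-adjoint operator `A`
(the trivial group if `A` generates no unitary group). -/
def unitaryGroup {H : Type} [NormedAddCommGroup H] [InnerProductSpace ℂ H]
    (A : H →ₗ.[ℂ] H) : ℝ → H ≃ₗᵢ[ℂ] H :=
  if h : ∃ U, IsUnitaryGroupOf A U then h.choose else fun _ => LinearIsometryEquiv.refl ℂ H

/-- The quadratic form `⟨ψ, H ψ⟩` of the free Hamiltonian
`H = ½ ∫ :(π² + (∇φ)² + m² φ²): dx`, that is of the second quantization `dΓ(ω)`: the nonnegative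
operator that multiplies the `n`-particle component by `ω(k₁) + ⋯ + ω(kₙ)`. Its value is `∞`
exactly outside the form domain of `H`. -/
def energyForm (m : ℝ) (ψ : FockSpace) : ℝ≥0∞ :=
  ∑' n : ℕ, ∫⁻ k : Fin n → ℝ,
    ENNReal.ofReal (∑ j, omega m (k j)) * ‖((ψ n : L2n n) : (Fin n → ℝ) → ℂ) k‖ₑ ^ 2

/-- `ψ` lies in the quadratic form domain of `H`. -/
def InFormDomain (m : ℝ) (ψ : FockSpace) : Prop := energyForm m ψ < ∞

/-- The energy expectation `⟨ψ, H ψ⟩` of a vector in the form domain. -/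
def energy (m : ℝ) (ψ : FockSpace) : ℝ := (energyForm m ψ).toReal

/-! ### Dipole states of the Schwinger model and confinement -/

/-- The dynamically generated photon mass `m = e / √π`. -/
def photonMass (e : ℝ) : ℝ := e / Real.sqrt Real.pi

/-- `g` equals `1` on `[0, R]` and `0` outside `(-ε, R + ε)`. -/
def IsStringProfile (R ε : ℝ) (g : ℝ → ℝ) : Prop :=
  (∀ x, 0 ≤ x → x ≤ R → g x = 1) ∧ ∀ x, x ≤ -ε ∨ R + ε ≤ x → g x = 0

/-- The dipole state `exp [i √π π(g)] Ω`. -/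
def dipoleState (e : ℝ) (g : 𝓢(ℝ, ℝ)) : FockSpace :=
  unitaryGroup (fieldMomentum (photonMass e) g) (Real.sqrt Real.pi) vacuum

/-- A family `Ψ_R`, `R > 0`, of states has finite energy: every `Ψ_R` lies in the quadratic form
domain of `H`, and `limsup_{R → ∞} ⟨Ψ_R, H Ψ_R⟩ < ∞`. -/
def HasFiniteEnergy (m : ℝ) (Ψ : ℝ → FockSpace) : Prop :=
  (∀ R, 0 < R → InFormDomain m (Ψ R)) ∧
    Filter.limsup (fun R => (energy m (Ψ R) : EReal)) Filter.atTop < ⊤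

/-- Confinement of the fermions associated with a family `Ψ_R`, `R > 0`, of dipole states: the
states lie in the quadratic form domain of `H`, so that `⟨Ψ_R, H Ψ_R⟩` is meaningful, but the
family does not have finite energy, that is, `limsup_{R → ∞} ⟨Ψ_R, H Ψ_R⟩ = ∞`. -/
def FermionsConfined (m : ℝ) (Ψ : ℝ → FockSpace) : Prop :=
  (∀ R, 0 < R → InFormDomain m (Ψ R)) ∧ ¬ HasFiniteEnergy m Ψ ∧
    Filter.limsup (fun R => (energy m (Ψ R) : EReal)) Filter.atTop = ⊤

end Schwinger

end

noncomputable section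

namespace Schwinger

open Finset Filter Topology

/-! ### Unitary groups from entire vectors -/

/-! The dipole state is a coherent state, and its energy is the classical energy of its profile.
With `h = ω^{1/2} ĝ`, the operator `i π(g)` is `2^{-1/2} (a(h) - a*(h))`. Its exponential at time
`t`, applied to the vacuum, has `n`-particle component `exp(-t²‖h‖²/4) (-t/√2)ⁿ h^{⊗n} / √n!`. The
particle number is therefore Poisson distributed, and the energy is `(t²/2) ∫ ω |h|²`
(`energyForm_coherent`). At `t = √π` this is `(π/2) ∫ (k² + m²) |ĝ|²`, which is finite since `g` is
Schwartz. Dropping `k²` and applying Plancherel leaves at least `(π/2) m² ∫ g²`, where `m² = e²/π`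
and `∫ g² ≥ R`; hence the linear bound with slope `e²/2`.

The analytic work is to identify the abstract exponential. Finite-particle vectors are entire for
the generator (`entireSeq_segalEnd`), so the exponential series yields a unitary group
(`exists_isUnitaryGroupOf`) and `unitaryGroup` is not its default value. For any such group `U`, the
truncated coherent state solves the evolution equation up to boundary terms that vanish in the limit
(`sum_coherent_error`). This determines `U T vacuum` (`tendsto_coherentSum`) without appeal to
self-adjointness or uniqueness of the group. -/

theorem sum_antidiagonal_pow_div_factorial {K : Type*} [Field K] [CharZero K] (a b : K) (n : ℕ) :
    ∑ p ∈ antidiagonal n, a ^ p.1 / (p.1.factorial : K) * (b ^ p.2 / (p.2.factorial : K)) =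
      (a + b) ^ n / (n.factorial : K) := by
  rw [(Commute.all a b).add_pow', Finset.sum_div]
  refine Finset.sum_congr rfl fun p hp => ?_
  have hp' : p.1 + p.2 = n := mem_antidiagonal.1 hp
  have h := Nat.add_choose_mul_factorial_mul_factorial p.1 p.2
  rw [hp', Nat.choose_symm_of_eq_add (hp'.symm.trans (add_comm _ _))] at h
  have h' : (n.choose p.1 : K) * p.1.factorial * p.2.factorial = n.factorial := by exact_mod_cast h
  have h1 : (p.1.factorial : K) ≠ 0 := by exact_mod_cast p.1.factorial_ne_zero
  have h2 : (p.2.factorial : K) ≠ 0 := by exact_mod_cast p.2.factorial_ne_zero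
  have h3 : (n.choose p.1 : K) ≠ 0 := by
    exact_mod_cast (Nat.choose_pos (by omega)).ne'
  rw [← h', nsmul_eq_mul]
  field_simp

/-- Coefficients of an exponential series that converges everywhere. -/
def EntireSeq {E : Type*} [NormedAddCommGroup E] (F : ℕ → E) : Prop :=
  ∀ r : ℝ, Summable fun k => r ^ k / (k.factorial : ℝ) * ‖F k‖

/-- The exponential generating series `∑ zᵏ/k! Fₖ`. -/
def expSeries {E : Type*} [NormedAddCommGroup E] [NormedSpace ℂ E] (F : ℕ → E) (z : ℂ) : E :=
  ∑' k, (z ^ k / (k.factorial : ℂ)) • F k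

/-! ### Everywhere convergent exponential series in a Banach space -/

section Series

variable {E : Type*} [NormedAddCommGroup E] [NormedSpace ℂ E] {F : ℕ → E}

theorem norm_pow_div_factorial (z : ℂ) (k : ℕ) :
    ‖z ^ k / (k.factorial : ℂ)‖ = ‖z‖ ^ k / (k.factorial : ℝ) := by
  simp

theorem EntireSeq.summable_norm (hF : EntireSeq F) (z : ℂ) :
    Summable fun k => ‖(z ^ k / (k.factorial : ℂ)) • F k‖ := by
  simpa only [norm_smul, norm_pow_div_factorial] using hF ‖z‖

theorem expSeries_zero : expSeries F 0 = F 0 := by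
  rw [expSeries, tsum_eq_single 0]
  · simp
  · intro k hk
    simp [hk]

variable [CompleteSpace E]

theorem EntireSeq.hasSum (hF : EntireSeq F) (z : ℂ) :
    HasSum (fun k => (z ^ k / (k.factorial : ℂ)) • F k) (expSeries F z) :=
  (hF.summable_norm z).of_norm.hasSum

/-- Grouping the double series along `p.1 + p.2 = n` gives binomial sums, and absolute convergence
at radius `‖s‖ + ‖t‖` permits the regrouping. It serves twice: for the group law, and with opposite
arguments for isometry. -/
theorem EntireSeq.hasSum_add (hF : EntireSeq F) (s t : ℂ) :
    HasSum (fun p : ℕ × ℕ => (s ^ p.1 / (p.1.factorial : ℂ) * (t ^ p.2 / (p.2.factorial : ℂ))) •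
      F (p.1 + p.2)) (expSeries F (s + t)) := by
  have hn : Summable (fun p : ℕ × ℕ => ‖(s ^ p.1 / (p.1.factorial : ℂ) *
      (t ^ p.2 / (p.2.factorial : ℂ))) • F (p.1 + p.2)‖) := by
    rw [← Finset.HasAntidiagonal.sigmaAntidiagonalEquivProd.summable_iff]
    refine (summable_sigma_of_nonneg fun _ => norm_nonneg _).2 ⟨fun n => Summable.of_finite, ?_⟩
    refine (hF (‖s‖ + ‖t‖)).congr fun n => ?_
    rw [← sum_antidiagonal_pow_div_factorial, Finset.sum_mul, tsum_fintype,
      ← Finset.sum_coe_sort (antidiagonal n)]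
    refine Finset.sum_congr rfl fun p _ => ?_
    have hp : p.1.1 + p.1.2 = n := mem_antidiagonal.1 p.2
    simp [norm_smul, hp]
  have hs := hn.of_norm
  have h1 := hs.hasSum
  rw [← Finset.HasAntidiagonal.sigmaAntidiagonalEquivProd.hasSum_iff] at h1
  have h2 := h1.sigma (fun n => (hasSum_fintype _))
  have h3 := hF.hasSum (s + t)
  have h4 : (fun k => ((s + t) ^ k / (k.factorial : ℂ)) • F k) = fun n : ℕ =>
      ∑ p : antidiagonal n, ((fun p : ℕ × ℕ => (s ^ p.1 / (p.1.factorial : ℂ) *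
        (t ^ p.2 / (p.2.factorial : ℂ))) • F (p.1 + p.2)) ∘
          Finset.HasAntidiagonal.sigmaAntidiagonalEquivProd) ⟨n, p⟩ := by
    funext n
    rw [← sum_antidiagonal_pow_div_factorial, Finset.sum_smul,
      ← Finset.sum_coe_sort (antidiagonal n)]
    refine Finset.sum_congr rfl fun p _ => ?_
    have hp : p.1.1 + p.1.2 = n := mem_antidiagonal.1 p.2
    simp [hp]
  rw [h4] at h3
  rw [h3.unique h2]
  exact hs.hasSum

/-- Every term of index at least 2 contains a factor `z²`; what remains is dominated by the series
at radius 1. The quadratic remainder gives the derivative at 0. -/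
theorem EntireSeq.norm_expSeries_sub_le (hF : EntireSeq F) {z : ℂ} (hz : ‖z‖ ≤ 1) :
    ‖expSeries F z - F 0 - z • F 1‖ ≤
      (∑' k, (1 : ℝ) ^ k / (k.factorial : ℝ) * ‖F k‖) * ‖z‖ ^ 2 := by
  have h1 := hF.hasSum z
  have h2 := (hasSum_nat_add_iff' 2).2 h1
  have e : expSeries F z - ∑ i ∈ range 2, (z ^ i / (i.factorial : ℂ)) • F i =
      expSeries F z - F 0 - z • F 1 := by
    simp [Finset.sum_range_succ, sub_sub]
  rw [e] at h2
  rw [← h2.tsum_eq, ← tsum_mul_right]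
  have hs := (hF 1).mul_right (‖z‖ ^ 2)
  have h3 : ∀ k, ‖(z ^ (k + 2) / ((k + 2).factorial : ℂ)) • F (k + 2)‖ ≤
      (1 : ℝ) ^ (k + 2) / ((k + 2).factorial : ℝ) * ‖F (k + 2)‖ * ‖z‖ ^ 2 := by
    intro k
    rw [norm_smul, norm_pow_div_factorial, pow_add, one_pow]
    have : ‖z‖ ^ k ≤ 1 := pow_le_one₀ (norm_nonneg _) hz
    have h5 : ‖z‖ ^ k * ‖z‖ ^ 2 ≤ 1 * ‖z‖ ^ 2 := by gcongr
    calc _ ≤ 1 * ‖z‖ ^ 2 / ((k + 2).factorial : ℝ) * ‖F (k + 2)‖ := by gcongr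
      _ = _ := by ring
  refine (tsum_of_norm_bounded ((summable_nat_add_iff 2).2 hs).hasSum h3).trans ?_
  rw [← hs.sum_add_tsum_nat_add 2]
  refine le_add_of_nonneg_left (Finset.sum_nonneg fun k _ => by positivity)

theorem EntireSeq.hasDerivAt_expSeries (hF : EntireSeq F) :
    HasDerivAt (fun t : ℝ => expSeries F t) (F 1) 0 := by
  rw [hasDerivAt_iff_isLittleO_nhds_zero]
  refine Asymptotics.IsBigO.trans_isLittleO (g := fun h : ℝ => ‖h‖ ^ 2) ?_ ?_
  · refine Asymptotics.IsBigO.of_bound (∑' k, (1 : ℝ) ^ k / (k.factorial : ℝ) * ‖F k‖) ?_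
    filter_upwards [Metric.ball_mem_nhds (0 : ℝ) one_pos] with h hh
    have : ‖(h : ℂ)‖ ≤ 1 := by
      rw [Complex.norm_real]
      exact (mem_ball_zero_iff.1 hh).le
    have key := hF.norm_expSeries_sub_le this
    rw [Complex.norm_real] at key
    simpa [expSeries_zero] using key
  · simpa using Asymptotics.isLittleO_norm_pow_id (E' := ℝ) one_lt_two

end Series

/-! ### The unitary group of a skew-symmetric operator with entire vectors -/

section Flow

variable {H : Type} [NormedAddCommGroup H] [InnerProductSpace ℂ H] [CompleteSpace H]
  {D : Submodule ℂ H} {B : Module.End ℂ D}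

/-- The exponential series of an operator all of whose domain vectors are entire. -/
def expFlow (B : Module.End ℂ D) (hB : ∀ x : D, EntireSeq fun k => ((B ^ k) x : H)) (z : ℂ) :
    D →ₗ[ℂ] H where
  toFun x := expSeries (fun k => ((B ^ k) x : H)) z
  map_add' x y := by
    refine ((hB (x + y)).hasSum z).unique ?_
    simpa using ((hB x).hasSum z).add ((hB y).hasSum z)
  map_smul' c x := by
    refine ((hB (c • x)).hasSum z).unique ?_
    simpa [smul_comm c] using ((hB x).hasSum z).const_smul c

theorem hasSum_expFlow (hB : ∀ x : D, EntireSeq fun k => ((B ^ k) x : H)) (z : ℂ) (x : D) :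
    HasSum (fun k => (z ^ k / (k.factorial : ℂ)) • ((B ^ k) x : H)) (expFlow B hB z x) :=
  (hB x).hasSum z

omit [CompleteSpace H] in
theorem inner_pow_of_skew (hskew : ∀ x y : D, inner ℂ (B x : H) y = -inner ℂ (x : H) (B y))
    (m : ℕ) (x y : D) : inner ℂ ((B ^ m) x : H) y = (-1) ^ m * inner ℂ (x : H) ((B ^ m) y) := by
  induction m generalizing y with
  | zero => simp
  | succ m ih =>
    rw [pow_succ' B, Module.End.mul_apply, hskew, ih, ← Module.End.mul_apply, ← pow_succ,
      ← pow_succ', pow_succ (-1 : ℂ)]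
    ring

omit [CompleteSpace H] in
theorem entireSeq_inner (x y : D) (hB : ∀ x : D, EntireSeq fun k => ((B ^ k) x : H)) :
    EntireSeq fun k => inner ℂ (x : H) ((B ^ k) y : H) := by
  intro r
  refine Summable.of_norm_bounded (((hB y) |r|).mul_left ‖(x : H)‖) fun k => ?_
  rw [norm_mul, norm_norm, norm_div, norm_pow, Real.norm_eq_abs, Real.norm_natCast]
  calc _ ≤ |r| ^ k / (k.factorial : ℝ) * (‖(x : H)‖ * ‖((B ^ k) y : H)‖) := by
        gcongr; exact norm_inner_le_norm _ _
    _ = _ := by ring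

/-- Skew-symmetry moves `B ^ m` across the inner product at the cost of `(-1) ^ m`. The left side
thus becomes the double series of `⟨x, Bᵏ y⟩` with arguments `-t` and `t`, whose sum is the series
at 0. -/
theorem inner_expFlow (hB : ∀ x : D, EntireSeq fun k => ((B ^ k) x : H))
    (hskew : ∀ x y : D, inner ℂ (B x : H) y = -inner ℂ (x : H) (B y)) (t : ℝ) (x y : D) :
    inner ℂ (expFlow B hB t x) (expFlow B hB t y) = inner ℂ (x : H) (y : H) := by
  have h1 := (entireSeq_inner x y hB).hasSum_add (-(t : ℂ)) t
  rw [neg_add_cancel, expSeries_zero] at h1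
  have h2 := h1.prod_fiberwise (g := fun m => ((t : ℂ) ^ m / (m.factorial : ℂ)) *
      inner ℂ ((B ^ m) x : H) (expFlow B hB t y)) (fun m => by
    have h3 := (((hasSum_expFlow hB t y).mapL (innerSL ℂ ((B ^ m) x : H)))).mul_left
      ((t : ℂ) ^ m / (m.factorial : ℂ))
    refine h3.congr_fun fun n => ?_
    have e : (-(t : ℂ)) ^ m = (-1) ^ m * (t : ℂ) ^ m := by rw [← mul_pow]; simp
    have e1 : ((-1 : ℂ) ^ m) * (-1) ^ m = 1 := by rw [← mul_pow]; simp
    rw [innerSL_apply_apply, inner_smul_right, inner_pow_of_skew hskew, pow_add,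
      Module.End.mul_apply, e, smul_eq_mul]
    ring)
  have h4 : HasSum (fun m => inner ℂ (((t : ℂ) ^ m / (m.factorial : ℂ)) • ((B ^ m) x : H))
      (expFlow B hB t y)) (inner ℂ (expFlow B hB t x) (expFlow B hB t y)) :=
    (hasSum_expFlow hB t x).map (innerₛₗ ℂ |>.flip (expFlow B hB t y)) (by
      exact continuous_id.inner continuous_const)
  refine h4.unique ?_
  refine h2.congr_fun fun m => ?_
  rw [inner_smul_left]
  simp

variable (hB : ∀ x : D, EntireSeq fun k => ((B ^ k) x : H))
    (hskew : ∀ x y : D, inner ℂ (B x : H) y = -inner ℂ (x : H) (B y)) (hD : Dense (D : Set H))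

include hskew in
theorem norm_expFlow (t : ℝ) (x : D) : ‖expFlow B hB t x‖ = ‖(x : H)‖ := by
  have h := inner_expFlow hB hskew t x x
  rw [inner_self_eq_norm_sq_to_K, inner_self_eq_norm_sq_to_K] at h
  have h' : ‖expFlow B hB t x‖ ^ 2 = ‖(x : H)‖ ^ 2 := by exact_mod_cast h
  exact (sq_eq_sq₀ (norm_nonneg _) (norm_nonneg _)).1 h'

/-- The continuous extension of `expFlow` to the whole space. -/
def expExtend (B : Module.End ℂ D) (hB : ∀ x : D, EntireSeq fun k => ((B ^ k) x : H)) (t : ℝ) :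
    H →L[ℂ] H :=
  (expFlow B hB t).extendOfNorm D.subtype

omit [CompleteSpace H] in
include hD in
theorem denseRange_subtype : DenseRange D.subtype := by
  simpa [DenseRange] using hD

include hskew hD in
theorem expExtend_coe (t : ℝ) (x : D) : expExtend B hB t x = expFlow B hB t x :=
  LinearMap.extendOfNorm_eq (denseRange_subtype hD)
    ⟨1, fun x => by rw [norm_expFlow hB hskew, one_mul]; rfl⟩ x

include hskew hD in
theorem norm_expExtend (t : ℝ) (x : H) : ‖expExtend B hB t x‖ = ‖x‖ := by
  refine isClosed_property (p := fun x => ‖expExtend B hB t x‖ = ‖x‖) (denseRange_subtype hD)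
    (isClosed_eq ?_ continuous_norm) (fun x => ?_) x
  · exact (expExtend B hB t).continuous.norm
  · exact (congrArg norm (expExtend_coe hB hskew hD t x)).trans (norm_expFlow hB hskew t x)

include hskew hD in
-- The flow need not preserve `D`, so the composition makes sense only for the extension. On `D` the
-- bounded operator at time `s` is applied termwise to the series at time `t`; density does the
-- rest.
theorem expExtend_expExtend (s t : ℝ) (x : H) :
    expExtend B hB s (expExtend B hB t x) = expExtend B hB (s + t) x := by
  refine isClosed_property
    (p := fun x => expExtend B hB s (expExtend B hB t x) = expExtend B hB (s + t) x)
    (denseRange_subtype hD) (isClosed_eq ?_ ?_) (fun x => ?_) x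
  · exact (expExtend B hB s).continuous.comp (expExtend B hB t).continuous
  · exact (expExtend B hB (s + t)).continuous
  · rw [Submodule.subtype_apply, expExtend_coe hB hskew hD, expExtend_coe hB hskew hD]
    have h1 := (hB x).hasSum_add t s
    have h2 := h1.prod_fiberwise (g := fun n => ((t : ℂ) ^ n / (n.factorial : ℂ)) •
        expExtend B hB s ((B ^ n) x : H)) (fun n => by
      rw [expExtend_coe hB hskew hD]
      refine ((hasSum_expFlow hB s ((B ^ n) x)).const_smul
        ((t : ℂ) ^ n / (n.factorial : ℂ))).congr_fun fun m => ?_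
      rw [smul_smul, add_comm, pow_add, Module.End.mul_apply])
    have h3 := (hasSum_expFlow hB t x).mapL (expExtend B hB s)
    simp only [map_smul] at h3
    refine (h3.unique h2).trans ?_
    rw [add_comm, ← Complex.ofReal_add]
    rfl

theorem expFlow_zero (x : D) : expFlow B hB 0 x = x := by
  change expSeries _ _ = _
  rw [expSeries_zero]
  simp

include hskew hD in
theorem expExtend_zero (x : H) : expExtend B hB 0 x = x := by
  refine isClosed_property (p := fun x => expExtend B hB 0 x = x) (denseRange_subtype hD)
    (isClosed_eq ?_ continuous_id) (fun x => ?_) x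
  · exact (expExtend B hB 0).continuous
  · rw [Submodule.subtype_apply, expExtend_coe hB hskew hD, Complex.ofReal_zero, expFlow_zero]

include hskew hD in
-- On `D`, differentiability at 0 gives continuity there, and the group law carries it to every
-- time. Since each operator is isometric, approximating `x` from `D` approximates its orbit
-- uniformly in time.
theorem continuous_expExtend (x : H) : Continuous fun t => expExtend B hB t x := by
  have h0 : ∀ x : D, Continuous fun t => expExtend B hB t x := by
    intro x
    have hc : ContinuousAt (fun t : ℝ => expFlow B hB t x) 0 :=
      (hB x).hasDerivAt_expSeries.continuousAt
    rw [continuous_iff_continuousAt]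
    intro t
    have hc' : ContinuousAt (fun s : ℝ => expExtend B hB t (expFlow B hB ((s - t : ℝ) : ℂ) x)) t := by
      refine (expExtend B hB t).continuous.continuousAt.comp
        (ContinuousAt.comp (f := fun s : ℝ => s - t) (g := fun s : ℝ => expFlow B hB s x) ?_ ?_)
      · rwa [sub_self]
      · fun_prop
    refine hc'.congr (Eventually.of_forall fun s => ?_)
    change expExtend B hB t (expFlow B hB ((s - t : ℝ) : ℂ) x) = expExtend B hB s x
    rw [← expExtend_coe hB hskew hD, expExtend_expExtend hB hskew hD, add_sub_cancel]
  refine continuous_of_uniform_approx_of_continuous fun u hu => ?_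
  obtain ⟨δ, hδ, hu⟩ := Metric.mem_uniformity_dist.1 hu
  obtain ⟨y, hy, hxy⟩ := Metric.dense_iff.1 hD x δ hδ
  refine ⟨_, h0 ⟨y, hxy⟩, fun t => hu ?_⟩
  rw [dist_eq_norm, ← map_sub, norm_expExtend hB hskew hD, ← dist_eq_norm]
  exact Metric.mem_ball'.1 hy

include hB hskew hD in
/-- A skew-symmetric operator, all of whose domain vectors are entire, generates a unitary
group. -/
theorem exists_isUnitaryGroupOf (A : H →ₗ.[ℂ] H) (hA : A.domain = D)
    (hAB : ∀ (x : D) (hx : (x : H) ∈ A.domain), (B x : H) = Complex.I • A ⟨x, hx⟩) :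
    ∃ U, IsUnitaryGroupOf A U := by
  refine ⟨fun t => LinearIsometryEquiv.mk
    (LinearEquiv.ofLinearMap (expExtend B hB t).toLinearMap (expExtend B hB (-t)).toLinearMap
      (LinearMap.ext fun x => ?_) (LinearMap.ext fun x => ?_)) ?_, ?_, ?_, ?_⟩
  · simp [expExtend_expExtend hB hskew hD, expExtend_zero hB hskew hD]
  · simp [expExtend_expExtend hB hskew hD, expExtend_zero hB hskew hD]
  · exact norm_expExtend hB hskew hD t
  · exact fun s t x => (expExtend_expExtend hB hskew hD s t x).symm
  · exact continuous_expExtend hB hskew hD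
  · rintro ⟨x, hx⟩
    have hx' : x ∈ D := hA ▸ hx
    have h := (hB ⟨x, hx'⟩).hasDerivAt_expSeries
    rw [pow_one, hAB ⟨x, hx'⟩ hx] at h
    refine h.congr_of_eventuallyEq (Eventually.of_forall fun t => ?_)
    exact expExtend_coe hB hskew hD t ⟨x, hx'⟩

end Flow

/-! ### Number estimates for creation and annihilation operators -/

section Bounds

variable (h : Lp ℂ 2 (volume : Measure ℝ))

theorem norm_tensorLeft (n : ℕ) (f : L2n n) : ‖tensorLeft n h f‖ = ‖h‖ * ‖f‖ :=
  norm_tensor h f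

theorem norm_creationN_le (n : ℕ) : ‖creationN n h‖ ≤ Real.sqrt (n + 1) * ‖h‖ := by
  refine ContinuousLinearMap.opNorm_le_bound _ (by positivity) fun f => ?_
  rw [creationN, _root_.smul_apply, norm_smul, Complex.norm_real, Real.norm_eq_abs,
    abs_of_nonneg (Real.sqrt_nonneg _), mul_assoc]
  gcongr
  refine ((nParticle (n + 1)).norm_orthogonalProjectionOnto_apply_le _).trans ?_
  exact (norm_tensorLeft h n f).le

theorem norm_annihilationN_le (n : ℕ) : ‖annihilationN n h‖ ≤ Real.sqrt (n + 1) * ‖h‖ := by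
  rw [annihilationN, LinearIsometryEquiv.norm_map]
  exact norm_creationN_le h n

theorem hasSum_norm_sq (ψ : FockSpace) : HasSum (fun n => ‖ψ n‖ ^ 2) (‖ψ‖ ^ 2) := by
  simpa using lp.hasSum_norm (p := 2) (by simp) ψ

theorem norm_le_of_raise {u ψ : FockSpace} {C : ℝ} (hC : 0 ≤ C) (h0 : u 0 = 0)
    (hs : ∀ n, ‖u (n + 1)‖ ≤ C * ‖ψ n‖) : ‖u‖ ≤ C * ‖ψ‖ := by
  refine (sq_le_sq₀ (norm_nonneg _) (by positivity)).1 ?_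
  have h1 := (hasSum_nat_add_iff' 1).2 (hasSum_norm_sq u)
  rw [Finset.sum_range_one, h0, norm_zero, zero_pow two_ne_zero, sub_zero] at h1
  rw [mul_pow]
  refine hasSum_le (fun n => ?_) h1 ((hasSum_norm_sq ψ).mul_left (C ^ 2))
  rw [← mul_pow]
  exact pow_le_pow_left₀ (norm_nonneg _) (hs n) 2

theorem norm_le_of_lower {u ψ : FockSpace} {C : ℝ} (hC : 0 ≤ C)
    (hs : ∀ n, ‖u n‖ ≤ C * ‖ψ (n + 1)‖) : ‖u‖ ≤ C * ‖ψ‖ := by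
  refine (sq_le_sq₀ (norm_nonneg _) (by positivity)).1 ?_
  have h1 := (hasSum_nat_add_iff' 1).2 (hasSum_norm_sq ψ)
  rw [Finset.sum_range_one] at h1
  rw [mul_pow]
  refine (hasSum_le (fun n => ?_) (hasSum_norm_sq u) (h1.mul_left (C ^ 2))).trans ?_
  · rw [← mul_pow]
    exact pow_le_pow_left₀ (norm_nonneg _) (hs n) 2
  · gcongr
    exact sub_le_self _ (sq_nonneg _)

/-- Only components with `n + 1 ≤ N` contribute, so the factor `√(n+1)` is at most `√N`. This
square-root growth is what makes finite-particle vectors entire. -/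
theorem norm_creation_le {N : ℕ} {ψ : finiteParticle} (hψ : ∀ n, N ≤ n → (ψ : FockSpace) n = 0) :
    ‖creation h ψ‖ ≤ Real.sqrt N * ‖h‖ * ‖(ψ : FockSpace)‖ := by
  refine norm_le_of_raise (by positivity) rfl fun n => ?_
  change ‖creationN n h ((ψ : FockSpace) n)‖ ≤ _
  rcases lt_or_ge n N with hn | hn
  · refine ((creationN n h).le_opNorm _).trans ?_
    gcongr
    refine (norm_creationN_le h n).trans ?_
    gcongr
    exact_mod_cast hn
  · rw [hψ n hn]
    simp

theorem norm_annihilation_le {N : ℕ} {ψ : finiteParticle}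
    (hψ : ∀ n, N ≤ n → (ψ : FockSpace) n = 0) :
    ‖annihilation h ψ‖ ≤ Real.sqrt N * ‖h‖ * ‖(ψ : FockSpace)‖ := by
  refine norm_le_of_lower (by positivity) fun n => ?_
  change ‖annihilationN n h ((ψ : FockSpace) (n + 1))‖ ≤ _
  rcases lt_or_ge (n + 1) N with hn | hn
  · refine ((annihilationN n h).le_opNorm _).trans ?_
    gcongr
    refine (norm_annihilationN_le h n).trans ?_
    gcongr
    exact_mod_cast hn.le
  · rw [hψ (n + 1) hn]
    simp

theorem inner_creation (ψ φ : finiteParticle) :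
    inner ℂ (creation h ψ) (φ : FockSpace) = inner ℂ (ψ : FockSpace) (annihilation h φ) := by
  have h1 := (hasSum_nat_add_iff' 1).2 (lp.hasSum_inner (𝕜 := ℂ) (creation h ψ) (φ : FockSpace))
  have h0 : (creation h ψ) 0 = 0 := rfl
  rw [Finset.sum_range_one, h0, inner_zero_left, sub_zero] at h1
  refine h1.unique ?_
  refine (lp.hasSum_inner (𝕜 := ℂ) (ψ : FockSpace) (annihilation h φ)).congr_fun fun n => ?_
  exact (ContinuousLinearMap.adjoint_inner_right (creationN n h) _ _).symm

theorem inner_annihilation (ψ φ : finiteParticle) :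
    inner ℂ (annihilation h ψ) (φ : FockSpace) = inner ℂ (ψ : FockSpace) (creation h φ) := by
  rw [← inner_conj_symm, ← inner_creation, inner_conj_symm]

/-- The skew-symmetric operator `2^{-1/2} (a(h) - a*(h))` on finite-particle vectors. -/
def segalEnd : Module.End ℂ finiteParticle :=
  LinearMap.codRestrict finiteParticle
    (((Real.sqrt 2 : ℂ)⁻¹) • (annihilation h - creation h)) fun ψ =>
      finiteParticle.smul_mem _ (finiteParticle.sub_mem
        (annihilationFun_eventually_zero h ψ) (creationFun_eventually_zero h ψ))

theorem coe_segalEnd (ψ : finiteParticle) : (segalEnd h ψ : FockSpace) =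
    ((Real.sqrt 2 : ℂ)⁻¹) • (annihilation h ψ - creation h ψ) := rfl

theorem segalEnd_skew (ψ φ : finiteParticle) :
    inner ℂ (segalEnd h ψ : FockSpace) φ = -inner ℂ (ψ : FockSpace) (segalEnd h φ) := by
  rw [coe_segalEnd, coe_segalEnd, inner_smul_left, inner_smul_right, inner_sub_left,
    inner_sub_right, inner_creation, inner_annihilation, map_inv₀, Complex.conj_ofReal]
  ring

theorem segalEnd_apply_eq_zero {N : ℕ} {ψ : finiteParticle}
    (hψ : ∀ n, N ≤ n → (ψ : FockSpace) n = 0) (n : ℕ) (hn : N + 1 ≤ n) :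
    (segalEnd h ψ : FockSpace) n = 0 := by
  obtain ⟨n, rfl⟩ : ∃ m, n = m + 1 := ⟨n - 1, by omega⟩
  change (_ : ℂ) • (annihilationN (n + 1) h ((ψ : FockSpace) (n + 1 + 1)) -
    creationN n h ((ψ : FockSpace) n)) = 0
  rw [hψ (n + 1 + 1) (by omega), hψ n (by omega), map_zero, map_zero, sub_zero, smul_zero]

theorem norm_segalEnd_le {N : ℕ} {ψ : finiteParticle}
    (hψ : ∀ n, N ≤ n → (ψ : FockSpace) n = 0) :
    ‖(segalEnd h ψ : FockSpace)‖ ≤ 2 * ‖h‖ * Real.sqrt N * ‖(ψ : FockSpace)‖ := by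
  rw [coe_segalEnd, norm_smul]
  have h1 : ‖((Real.sqrt 2 : ℂ)⁻¹)‖ ≤ 1 := by
    rw [norm_inv, Complex.norm_real, Real.norm_eq_abs, abs_of_nonneg (Real.sqrt_nonneg _)]
    exact inv_le_one_of_one_le₀ (Real.one_le_sqrt.2 one_le_two)
  calc _ ≤ 1 * (‖annihilation h ψ‖ + ‖creation h ψ‖) := by
        gcongr; exact norm_sub_le _ _
    _ ≤ 1 * (Real.sqrt N * ‖h‖ * ‖(ψ : FockSpace)‖ + Real.sqrt N * ‖h‖ * ‖(ψ : FockSpace)‖) := by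
        gcongr
        · exact norm_annihilation_le h hψ
        · exact norm_creation_le h hψ
    _ = _ := by ring

/-- After `k` applications the vector lives below particle number `N + k`, so the next application
costs at most `2‖h‖√(N+k)`. The factorial gains `k + 1`, and the ratio test applies. -/
theorem entireSeq_segalEnd (ψ : finiteParticle) :
    EntireSeq fun k => ((segalEnd h ^ k) ψ : FockSpace) := by
  intro r
  obtain ⟨N, hN⟩ := ψ.2
  have hz : ∀ k n, N + k ≤ n → ((segalEnd h ^ k) ψ : FockSpace) n = 0 := by
    intro k
    induction k with
    | zero => exact hN
    | succ k ih =>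
      rw [pow_succ', Module.End.mul_apply]
      exact segalEnd_apply_eq_zero h ih
  set C := |r| * (2 * ‖h‖) with hC
  have hC0 : 0 ≤ C := by positivity
  refine summable_of_ratio_norm_eventually_le (r := 1 / 2) (by norm_num) ?_
  -- The threshold is chosen so that `4C²(N+k) ≤ 4C²(1+N)(k+1) ≤ (k+1)²`, which makes the ratio at
  -- most `1/2`.
  filter_upwards [eventually_ge_atTop ⌈4 * C ^ 2 * (1 + N)⌉₊] with k hk
  have hk' : 4 * C ^ 2 * (1 + N) ≤ (k : ℝ) := (Nat.le_ceil _).trans (by exact_mod_cast hk)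
  have hs : C * Real.sqrt ((N + k : ℕ) : ℝ) ≤ 1 / 2 * (k + 1) := by
    rw [← Real.sqrt_sq hC0, ← Real.sqrt_mul (sq_nonneg _)]
    refine Real.sqrt_le_iff.2 ⟨by positivity, ?_⟩
    push_cast
    have h1 : 4 * C ^ 2 * (1 + N) * (k + 1) ≤ (k : ℝ) * (k + 1) := by gcongr
    have h2 : 0 ≤ C ^ 2 * (N * k) := by positivity
    have h3 : 0 ≤ C ^ 2 := by positivity
    nlinarith
  have hb := norm_segalEnd_le h (hz k)
  rw [← Module.End.mul_apply, ← pow_succ'] at hb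
  set x := ‖((segalEnd h ^ k) ψ : FockSpace)‖
  set y := ‖((segalEnd h ^ (k + 1)) ψ : FockSpace)‖
  have hx : 0 ≤ x := norm_nonneg _
  rw [norm_mul, norm_mul, norm_div, norm_div, norm_pow, norm_pow, Real.norm_eq_abs,
    Real.norm_natCast, Real.norm_natCast, Real.norm_of_nonneg hx,
    Real.norm_of_nonneg (norm_nonneg _), Nat.factorial_succ, pow_succ]
  push_cast
  have hf : (0 : ℝ) < k.factorial := by positivity
  rw [div_mul_eq_mul_div, div_le_iff₀ (by positivity)]
  calc |r| ^ k * |r| * y ≤ |r| ^ k * |r| * (2 * ‖h‖ * Real.sqrt ((N + k : ℕ) : ℝ) * x) := by gcongr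
    _ = |r| ^ k * x * (C * Real.sqrt ((N + k : ℕ) : ℝ)) := by rw [hC]; ring
    _ ≤ |r| ^ k * x * (1 / 2 * (k + 1)) := by gcongr
    _ = _ := by field_simp

end Bounds

/-! ### The exponential of the field momentum -/

theorem dense_finiteParticle : Dense (finiteParticle : Set FockSpace) := by
  intro ψ
  refine mem_closure_of_tendsto (lp.hasSum_single (p := 2) (by simp) ψ)
    (Eventually.of_forall fun s => ?_)
  refine finiteParticle.sum_mem fun n _ => ⟨n + 1, fun k hk => ?_⟩
  exact lp.single_apply_ne 2 n _ (by omega)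

theorem I_smul_fieldMomentum (m : ℝ) (g : 𝓢(ℝ, ℝ)) (ψ : finiteParticle) :
    Complex.I • fieldMomentum m g ψ =
      segalEnd ((memLp_momentumFun m g).toLp (momentumFun m g)) ψ := by
  change Complex.I • ((Complex.I * (Real.sqrt 2 : ℂ)⁻¹) • (creation _ ψ - annihilation _ ψ)) = _
  rw [coe_segalEnd, smul_smul, ← mul_assoc, Complex.I_mul_I, neg_one_mul, neg_smul, ← smul_neg,
    neg_sub]

/-- The unitary group generated by the field momentum. -/
theorem isUnitaryGroupOf_fieldMomentum (m : ℝ) (g : 𝓢(ℝ, ℝ)) :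
    IsUnitaryGroupOf (fieldMomentum m g) (unitaryGroup (fieldMomentum m g)) := by
  -- Existence excludes the trivial-group default of `unitaryGroup`. The chosen group is known
  -- afterwards only through `IsUnitaryGroupOf`.
  have hex : ∃ U, IsUnitaryGroupOf (fieldMomentum m g) U := by
    refine exists_isUnitaryGroupOf
      (entireSeq_segalEnd ((memLp_momentumFun m g).toLp (momentumFun m g)))
      (segalEnd_skew _) dense_finiteParticle _ rfl fun ψ _ => ?_
    exact (I_smul_fieldMomentum m g ψ).symm
  rw [unitaryGroup, dif_pos hex]
  exact hex.choose_spec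

/-! ### Tensor powers of a one-particle vector -/

section TensorPow

variable (h : Lp ℂ 2 (volume : Measure ℝ))

/-- The function `h ⊗ ⋯ ⊗ h` of `n` momenta. -/
def tensorPowL2 : (n : ℕ) → L2n n
  | 0 => Lp.const 2 volume 1
  | n + 1 => tensorLeft n h (tensorPowL2 n)

theorem coeFn_tensorPowL2 (n : ℕ) : tensorPowL2 h n =ᵐ[volume] fun k => ∏ j, h (k j) := by
  induction n with
  | zero =>
    filter_upwards [Lp.coeFn_const (p := 2) (μ := (volume : Measure (Fin 0 → ℝ))) (1 : ℂ)] with k hk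
    rw [tensorPowL2, hk]
    simp
  | succ n ih =>
    have h1 : tensorPowL2 h (n + 1) =ᵐ[volume] tensorFun h (tensorPowL2 h n) :=
      (memLp_tensorFun h _).coeFn_toLp
    have h2 := (measurePreserving_split n).quasiMeasurePreserving.ae_eq_comp
      ((Measure.quasiMeasurePreserving_snd (μ := (volume : Measure ℝ))).ae_eq_comp ih)
    filter_upwards [h1, h2] with k hk1 hk2
    simp only [Function.comp_apply] at hk2
    rw [hk1, tensorFun, hk2, Fin.prod_univ_succ]
    rfl

theorem tensorPowL2_mem (n : ℕ) : tensorPowL2 h n ∈ nParticle n := by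
  intro σ
  refine Lp.ext ?_
  filter_upwards [Lp.coeFn_compMeasurePreserving (tensorPowL2 h n) (measurePreserving_perm σ),
    coeFn_tensorPowL2 h n, (measurePreserving_perm σ).quasiMeasurePreserving.ae_eq_comp
      (coeFn_tensorPowL2 h n)] with k h1 h2 h3
  rw [h1, h2, h3]
  exact Equiv.prod_comp σ fun j => h (k j)

theorem norm_tensorPowL2 (n : ℕ) : ‖tensorPowL2 h n‖ = ‖h‖ ^ n := by
  induction n with
  | zero =>
    refine (Lp.norm_const' (μ := (volume : Measure (Fin 0 → ℝ))) 2 (1 : ℂ) two_ne_zero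
      ENNReal.ofNat_ne_top).trans ?_
    simp [Measure.real, volume_pi]
  | succ n ih => rw [tensorPowL2, norm_tensorLeft, ih, pow_succ']

/-- The `n`-particle vector `h ⊗ ⋯ ⊗ h`. -/
def tensorPow (n : ℕ) : nParticle n := ⟨tensorPowL2 h n, tensorPowL2_mem h n⟩

/-- Polarization of `norm_tensorLeft`. -/
theorem inner_tensorLeft (n : ℕ) (f g : L2n n) :
    inner ℂ (tensorLeft n h f) (tensorLeft n h g) = (‖h‖ : ℂ) ^ 2 * inner ℂ f g := by
  rw [inner_eq_sum_norm_sq_div_four, inner_eq_sum_norm_sq_div_four, ← map_add, ← map_sub,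
    ← map_smul, ← map_add, ← map_sub]
  simp only [norm_tensorLeft, mul_pow, RCLike.ofReal_mul, Complex.coe_algebraMap]
  ring

/-- A tensor power is already symmetric, so the projection acts trivially. -/
theorem creationN_tensorPow (n : ℕ) :
    creationN n h (tensorPow h n) = (Real.sqrt (n + 1) : ℂ) • tensorPow h (n + 1) := by
  rw [creationN, _root_.smul_apply]
  congr 1
  exact Submodule.orthogonalProjectionOnto_mem_subspace_eq_self (tensorPow h (n + 1))

/-- Against an arbitrary `f` the adjoint becomes creation. The symmetrization drops out because the
other argument is symmetric, and one factor `⟨h, h⟩` splits off. -/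
theorem annihilationN_tensorPow (n : ℕ) :
    annihilationN n h (tensorPow h (n + 1)) =
      ((Real.sqrt (n + 1) : ℂ) * (‖h‖ : ℂ) ^ 2) • tensorPow h n := by
  refine ext_inner_left ℂ fun f => ?_
  rw [annihilationN, ContinuousLinearMap.adjoint_inner_right, creationN, _root_.smul_apply,
    inner_smul_left, Complex.conj_ofReal]
  refine Eq.trans ?_ (inner_smul_right f (tensorPow h n) _).symm
  rw [mul_assoc]
  congr 1
  refine (Submodule.inner_orthogonalProjectionOnto_eq_of_mem_right (tensorPow h (n + 1)) _).trans ?_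
  exact inner_tensorLeft h n f (tensorPowL2 h n)

/-- The inclusion of the `n`-particle space into Fock space. -/
def ofParticle (n : ℕ) (v : nParticle n) : FockSpace :=
  lp.single (E := fun n : ℕ => nParticle n) 2 n v

theorem ofParticle_self (n : ℕ) (v : nParticle n) : ofParticle n v n = v :=
  lp.single_apply_self (E := fun n : ℕ => nParticle n) 2 n v

theorem ofParticle_ne {n k : ℕ} (v : nParticle n) (hk : k ≠ n) : ofParticle n v k = 0 :=
  lp.single_apply_ne (E := fun n : ℕ => nParticle n) 2 n v hk

theorem ofParticle_smul (n : ℕ) (c : ℂ) (v : nParticle n) :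
    ofParticle n (c • v) = c • ofParticle n v :=
  lp.single_smul (E := fun n : ℕ => nParticle n) 2 n c v

theorem norm_ofParticle (n : ℕ) (v : nParticle n) : ‖ofParticle n v‖ = ‖v‖ :=
  lp.norm_single (E := fun n : ℕ => nParticle n) (by simp) n v

/-- A vector of the `n`-particle space as a finite-particle vector. -/
def singleParticle (n : ℕ) (v : nParticle n) : finiteParticle :=
  ⟨ofParticle n v, n + 1, fun k hk => ofParticle_ne v (by omega)⟩

theorem creation_single (n : ℕ) (v : nParticle n) :
    creation h (singleParticle n v) = ofParticle (n + 1) (creationN n h v) := by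
  refine lp.ext (funext fun k => ?_)
  rcases k with _ | k
  · exact (ofParticle_ne _ (by omega)).symm
  · change creationN k h (ofParticle n v k) = _
    rcases eq_or_ne k n with rfl | hk
    · rw [ofParticle_self, ofParticle_self]
    · rw [ofParticle_ne v hk, ofParticle_ne _ (by omega), map_zero]

theorem annihilation_single_succ (n : ℕ) (v : nParticle (n + 1)) :
    annihilation h (singleParticle (n + 1) v) = ofParticle n (annihilationN n h v) := by
  refine lp.ext (funext fun k => ?_)
  change annihilationN k h (ofParticle (n + 1) v (k + 1)) = _
  rcases eq_or_ne k n with rfl | hk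
  · rw [ofParticle_self, ofParticle_self]
  · rw [ofParticle_ne _ hk, ofParticle_ne v (by omega), map_zero]

theorem annihilation_single_zero (v : nParticle 0) :
    annihilation h (singleParticle 0 v) = 0 := by
  refine lp.ext (funext fun k => ?_)
  change annihilationN k h (ofParticle 0 v (k + 1)) = _
  rw [ofParticle_ne v (by omega), map_zero]
  rfl

/-- The vector `a*(h)ⁿ Ω / n! = h^{⊗ n} / √n!`. -/
def coherentTerm (n : ℕ) : finiteParticle :=
  singleParticle n (((Real.sqrt n.factorial : ℂ)⁻¹) • tensorPow h n)

theorem coe_coherentTerm_zero : (coherentTerm h 0 : FockSpace) = vacuum := by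
  simp only [coherentTerm, Nat.factorial_zero, Nat.cast_one, Real.sqrt_one, Complex.ofReal_one,
    inv_one, one_smul]
  exact congrArg (ofParticle 0) (Subtype.ext rfl)

theorem norm_coherentTerm (n : ℕ) :
    ‖(coherentTerm h n : FockSpace)‖ = ‖h‖ ^ n / Real.sqrt n.factorial := by
  refine (norm_ofParticle n _).trans ?_
  rw [norm_smul, norm_inv, Complex.norm_real, Real.norm_of_nonneg (Real.sqrt_nonneg _),
    inv_mul_eq_div]
  congr 1
  exact norm_tensorPowL2 h n

/-- The normalization `1/√n!` absorbs the square roots: creation acts with the coefficient `n + 1`,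
annihilation with `‖h‖²`. -/
theorem creation_coherentTerm (n : ℕ) :
    creation h (coherentTerm h n) = ((n : ℂ) + 1) • (coherentTerm h (n + 1) : FockSpace) := by
  rw [coherentTerm, creation_single, map_smul, creationN_tensorPow, smul_smul]
  change _ = _ • ofParticle (n + 1) _
  rw [← ofParticle_smul, smul_smul]
  congr 2
  have h1 : Real.sqrt (n + 1) ≠ 0 := by positivity
  have h2 : Real.sqrt n.factorial ≠ 0 := by positivity
  have h3 : Real.sqrt (n + 1) * Real.sqrt (n + 1) = n + 1 := Real.mul_self_sqrt (by positivity)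
  have : (Real.sqrt n.factorial)⁻¹ * Real.sqrt (n + 1) =
      ((n : ℝ) + 1) * (Real.sqrt (n + 1).factorial)⁻¹ := by
    rw [Nat.factorial_succ, Nat.cast_mul, Real.sqrt_mul (by positivity)]
    push_cast
    field_simp
    rw [sq, h3]
  exact_mod_cast this

theorem annihilation_coherentTerm_zero : annihilation h (coherentTerm h 0) = 0 :=
  annihilation_single_zero h _

theorem annihilation_coherentTerm_succ (n : ℕ) :
    annihilation h (coherentTerm h (n + 1)) = (‖h‖ : ℂ) ^ 2 • (coherentTerm h n : FockSpace) := by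
  rw [coherentTerm, annihilation_single_succ, map_smul, annihilationN_tensorPow, smul_smul]
  change _ = _ • ofParticle n _
  rw [← ofParticle_smul, smul_smul]
  congr 2
  have h1 : Real.sqrt (n + 1) ≠ 0 := by positivity
  have h2 : Real.sqrt n.factorial ≠ 0 := by positivity
  have : (Real.sqrt (n + 1).factorial)⁻¹ * (Real.sqrt (n + 1) * ‖h‖ ^ 2) =
      ‖h‖ ^ 2 * (Real.sqrt n.factorial)⁻¹ := by
    rw [Nat.factorial_succ, Nat.cast_mul, Real.sqrt_mul (by positivity)]
    push_cast
    field_simp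
  exact_mod_cast this

end TensorPow

/-! ### The coherent state generated from the vacuum -/

section Group

variable {H : Type} [NormedAddCommGroup H] [InnerProductSpace ℂ H] {A : H →ₗ.[ℂ] H}
  {U : ℝ → H ≃ₗᵢ[ℂ] H}

theorem IsUnitaryGroupOf.zero_apply (hU : IsUnitaryGroupOf A U) (ψ : H) : U 0 ψ = ψ := by
  have h := hU.add_apply 0 0 ψ
  rw [add_zero] at h
  exact ((U 0).injective h).symm

theorem IsUnitaryGroupOf.neg_apply (hU : IsUnitaryGroupOf A U) (t : ℝ) (ψ : H) :
    U (-t) (U t ψ) = ψ := by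
  rw [← hU.add_apply, neg_add_cancel, hU.zero_apply]

/-- The definition supplies a derivative at time 0 only; writing `U (-s) = U (-t) U (t - s)` moves
it to time `t`. -/
theorem IsUnitaryGroupOf.hasDerivAt_neg (hU : IsUnitaryGroupOf A U) (ψ : A.domain) (t : ℝ) :
    HasDerivAt (fun s => U (-s) (ψ : H)) (-U (-t) (Complex.I • A ψ)) t := by
  have h1 : HasDerivAt (fun s : ℝ => t - s) (-1) t := by
    simpa using (hasDerivAt_id t).const_sub t
  have h0 : HasDerivAt (fun s => U s (ψ : H)) (Complex.I • A ψ) (t - t) := by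
    rw [sub_self]; exact hU.hasDerivAt ψ
  have h2 := h0.scomp t h1
  have h3 := (((U (-t)).toContinuousLinearEquiv : H →L[ℂ] H).restrictScalars ℝ).hasFDerivAt
    |>.comp_hasDerivAt t h2
  have h4 : ((((U (-t)).toContinuousLinearEquiv : H →L[ℂ] H).restrictScalars ℝ)
      ((-1 : ℝ) • (Complex.I • A ψ))) = -U (-t) (Complex.I • A ψ) := by
    simp
  rw [h4] at h3
  refine h3.congr_of_eventuallyEq (Eventually.of_forall fun s => ?_)
  change U (-s) (ψ : H) = U (-t) (U (t - s) (ψ : H))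
  rw [← hU.add_apply]
  congr 2
  ring

end Group

/-! ### Truncated coherent states and their convergence -/

section Coherent

variable (h : Lp ℂ 2 (volume : Measure ℝ))

theorem segalEnd_coherentTerm_zero : (segalEnd h (coherentTerm h 0) : FockSpace) =
    -((Real.sqrt 2 : ℂ)⁻¹ • (coherentTerm h 1 : FockSpace)) := by
  rw [coe_segalEnd, annihilation_coherentTerm_zero, creation_coherentTerm]
  simp

theorem segalEnd_coherentTerm_succ (n : ℕ) : (segalEnd h (coherentTerm h (n + 1)) : FockSpace) =
    (Real.sqrt 2 : ℂ)⁻¹ • ((‖h‖ : ℂ) ^ 2 • (coherentTerm h n : FockSpace) -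
      ((n : ℂ) + 2) • (coherentTerm h (n + 2) : FockSpace)) := by
  rw [coe_segalEnd, annihilation_coherentTerm_succ, creation_coherentTerm]
  push_cast
  congr 3
  ring

/-- The coefficient `exp(-t² a / 4) (-t / √2)ⁿ` of the coherent state. -/
def coherentCoeff (a : ℝ) (n : ℕ) (t : ℝ) : ℝ :=
  Real.exp (-(t ^ 2 * a / 4)) * (-((Real.sqrt 2)⁻¹ * t)) ^ n

/-- The derivative of `coherentCoeff`. -/
def coherentCoeffDeriv (a : ℝ) : ℕ → ℝ → ℝ
  | 0, t => -(t * a / 2) * coherentCoeff a 0 t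
  | n + 1, t => -(t * a / 2) * coherentCoeff a (n + 1) t -
      (n + 1) * (Real.sqrt 2)⁻¹ * coherentCoeff a n t

theorem coherentCoeff_succ (a : ℝ) (n : ℕ) (t : ℝ) :
    coherentCoeff a (n + 1) t = -((Real.sqrt 2)⁻¹ * t) * coherentCoeff a n t := by
  rw [coherentCoeff, coherentCoeff, pow_succ]
  ring

theorem hasDerivAt_coherentCoeff (a : ℝ) (n : ℕ) (t : ℝ) :
    HasDerivAt (coherentCoeff a n) (coherentCoeffDeriv a n t) t := by
  have h1 : HasDerivAt (fun t : ℝ => Real.exp (-(t ^ 2 * a / 4)))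
      (Real.exp (-(t ^ 2 * a / 4)) * -(t * a / 2)) t := by
    refine HasDerivAt.exp ?_
    have := (((hasDerivAt_pow 2 t).mul_const a).div_const 4).neg
    refine this.congr_deriv ?_
    simp
    ring
  have h2 : HasDerivAt (fun t : ℝ => -((Real.sqrt 2)⁻¹ * t)) (-(Real.sqrt 2)⁻¹) t := by
    exact ((hasDerivAt_id t).const_mul (Real.sqrt 2)⁻¹).neg.congr_deriv (by simp)
  refine (h1.fun_mul (h2.fun_pow n)).congr_deriv ?_
  rcases n with _ | n
  · simp [coherentCoeffDeriv, coherentCoeff]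
    ring
  · simp only [coherentCoeffDeriv, coherentCoeff, Nat.add_sub_cancel]
    push_cast
    ring

/-- The full coherent series formally satisfies `ψ' = segalEnd h ψ`, so a truncation leaves only two
boundary terms: at level `N` the annihilation contribution from the missing level `N + 1`, and at
level `N + 1` the creation contribution from level `N`. -/
theorem sum_coherent_error (t : ℝ) (N : ℕ) :
    ∑ n ∈ range (N + 1), ((coherentCoeffDeriv (‖h‖ ^ 2) n t : ℂ) • (coherentTerm h n : FockSpace) -
        (coherentCoeff (‖h‖ ^ 2) n t : ℂ) • (segalEnd h (coherentTerm h n) : FockSpace)) =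
      (-(t * (‖h‖ : ℂ) ^ 2 / 2) * coherentCoeff (‖h‖ ^ 2) N t) • (coherentTerm h N : FockSpace) +
      ((Real.sqrt 2 : ℂ)⁻¹ * coherentCoeff (‖h‖ ^ 2) N t * ((N : ℂ) + 1)) •
        (coherentTerm h (N + 1) : FockSpace) := by
  have hs : (Real.sqrt 2 : ℂ)⁻¹ * (Real.sqrt 2 : ℂ)⁻¹ = 1 / 2 := by
    rw [← mul_inv, ← Complex.ofReal_mul, Real.mul_self_sqrt zero_le_two]
    norm_num
  induction N with
  | zero =>
    rw [Finset.sum_range_one, segalEnd_coherentTerm_zero, coherentCoeffDeriv]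
    push_cast
    module
  | succ N ih =>
    rw [Finset.sum_range_succ, ih, segalEnd_coherentTerm_succ, coherentCoeffDeriv,
      coherentCoeff_succ]
    push_cast
    generalize (Real.sqrt 2 : ℂ)⁻¹ = s at *
    -- At level `N` the old boundary term cancels the annihilation part of the new summand; this is
    -- where `(1/√2)² = 1/2` enters.
    linear_combination (norm := module)
      (t * coherentCoeff (‖h‖ ^ 2) N t * (‖h‖ : ℂ) ^ 2 * hs) • (coherentTerm h N : FockSpace)

theorem abs_coherentCoeff_le {a t T : ℝ} (ha : 0 ≤ a) (ht : 0 ≤ t) (htT : t ≤ T) (n : ℕ) :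
    |coherentCoeff a n t| ≤ (T + 1) ^ n := by
  rw [coherentCoeff, abs_mul, abs_of_pos (Real.exp_pos _), abs_pow, abs_neg, abs_mul,
    abs_of_nonneg ht, abs_of_nonneg (by positivity : 0 ≤ (Real.sqrt 2)⁻¹)]
  have h1 : Real.exp (-(t ^ 2 * a / 4)) ≤ 1 := Real.exp_le_one_iff.2 (by
    have : 0 ≤ t ^ 2 * a / 4 := by positivity
    linarith)
  have h2 : (Real.sqrt 2)⁻¹ ≤ 1 := inv_le_one_of_one_le₀ (Real.one_le_sqrt.2 one_le_two)
  calc _ ≤ 1 * (1 * (T + 1)) ^ n := by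
        gcongr
        linarith
    _ = _ := by simp

theorem tendsto_pow_div_sqrt_factorial (b : ℝ) :
    Tendsto (fun n : ℕ => b ^ n / Real.sqrt n.factorial) atTop (𝓝 0) := by
  have h1 := (FloorSemiring.tendsto_pow_div_factorial_atTop (b ^ 2)).sqrt
  rw [Real.sqrt_zero] at h1
  rw [tendsto_zero_iff_abs_tendsto_zero]
  refine h1.congr fun n => ?_
  rw [Real.sqrt_div' _ (by positivity), ← pow_mul, mul_comm, pow_mul, Real.sqrt_sq_eq_abs]
  simp [abs_div, abs_of_nonneg (Real.sqrt_nonneg _)]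

/-- The factor `N + 1` is absorbed as `2 ^ (N + 1)`, so both boundary terms are bounded by multiples
of `bⁿ/√n!`, uniformly on `[0, T]`. -/
theorem norm_coherent_error_le {t T : ℝ} (ht : 0 ≤ t) (htT : t ≤ T) (N : ℕ) :
    ‖(-(t * (‖h‖ : ℂ) ^ 2 / 2) * coherentCoeff (‖h‖ ^ 2) N t) • (coherentTerm h N : FockSpace) +
      ((Real.sqrt 2 : ℂ)⁻¹ * coherentCoeff (‖h‖ ^ 2) N t * ((N : ℂ) + 1)) •
        (coherentTerm h (N + 1) : FockSpace)‖ ≤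
    (T * ‖h‖ ^ 2 / 2) * (((T + 1) * ‖h‖) ^ N / Real.sqrt N.factorial) +
      (2 * (T + 1) * ‖h‖) ^ (N + 1) / Real.sqrt (N + 1).factorial := by
  have hT : 0 ≤ T := ht.trans htT
  have hc := abs_coherentCoeff_le (sq_nonneg ‖h‖) ht htT N
  refine (norm_add_le _ _).trans (add_le_add ?_ ?_)
  · rw [norm_smul, norm_coherentTerm, norm_mul, Complex.norm_real, Real.norm_eq_abs, norm_neg]
    have : ‖(t * (‖h‖ : ℂ) ^ 2 / 2)‖ = t * ‖h‖ ^ 2 / 2 := by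
      simp [abs_of_nonneg ht]
    rw [this, mul_pow]
    calc _ ≤ T * ‖h‖ ^ 2 / 2 * (T + 1) ^ N * (‖h‖ ^ N / Real.sqrt N.factorial) := by gcongr
      _ = _ := by ring
  · rw [norm_smul, norm_coherentTerm, norm_mul, norm_mul, Complex.norm_real, Real.norm_eq_abs]
    have h1 : ‖((Real.sqrt 2 : ℂ)⁻¹)‖ ≤ 1 := by
      rw [norm_inv, Complex.norm_real, Real.norm_eq_abs, abs_of_nonneg (Real.sqrt_nonneg _)]
      exact inv_le_one_of_one_le₀ (Real.one_le_sqrt.2 one_le_two)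
    have h2 : ‖(N : ℂ) + 1‖ ≤ 2 ^ (N + 1) := by
      have e : ((N : ℂ) + 1) = ((N + 1 : ℕ) : ℂ) := by push_cast; rfl
      rw [e, Complex.norm_natCast]
      exact_mod_cast Nat.lt_two_pow_self.le
    have h3 : (T + 1) ^ N ≤ (T + 1) ^ (N + 1) := pow_le_pow_right₀ (by linarith) (by omega)
    rw [mul_pow, mul_pow]
    calc _ ≤ 1 * (T + 1) ^ (N + 1) * 2 ^ (N + 1) *
          (‖h‖ ^ (N + 1) / Real.sqrt (N + 1).factorial) := by
          gcongr
          exact hc.trans h3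
      _ = _ := by ring

/-- Partial sums of the coherent state. -/
def coherentSum (N : ℕ) (t : ℝ) : FockSpace :=
  ∑ n ∈ range (N + 1), (coherentCoeff (‖h‖ ^ 2) n t : ℂ) • (coherentTerm h n : FockSpace)

theorem coherentSum_zero (N : ℕ) : coherentSum h N 0 = vacuum := by
  rw [coherentSum, Finset.sum_range_succ', Finset.sum_eq_zero, zero_add, coe_coherentTerm_zero]
  · simp [coherentCoeff]
  · intro n _
    simp [coherentCoeff]

theorem coherentSum_apply {N n : ℕ} (hn : n ≤ N) (t : ℝ) : coherentSum h N t n =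
    ((coherentCoeff (‖h‖ ^ 2) n t : ℂ) * (Real.sqrt n.factorial : ℂ)⁻¹) • tensorPow h n := by
  rw [coherentSum, lp.coeFn_sum, Finset.sum_apply, Finset.sum_eq_single n]
  · rw [lp.coeFn_smul, Pi.smul_apply, mul_smul]
    congr 1
    exact ofParticle_self n _
  · intro k _ hk
    rw [lp.coeFn_smul, Pi.smul_apply]
    refine (congrArg _ (ofParticle_ne _ hk.symm)).trans (smul_zero _)
  · intro hc
    exact absurd (Finset.mem_range.2 (by omega)) hc

variable {A : FockSpace →ₗ.[ℂ] FockSpace} {U : ℝ → FockSpace ≃ₗᵢ[ℂ] FockSpace}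

/-- Pulling the truncated state back by `U (-t)` leaves a curve that starts at the vacuum and whose
derivative is a rotated boundary error. The mean value inequality bounds its displacement on `[0,
T]` by `T` times the error bound, and unitarity transfers this to the distance from `U T vacuum`. -/
theorem tendsto_coherentSum (hU : IsUnitaryGroupOf A U)
    (hA : ∀ ψ : finiteParticle, ∃ hψ : (ψ : FockSpace) ∈ A.domain,
      Complex.I • A ⟨ψ, hψ⟩ = segalEnd h ψ) {T : ℝ} (hT : 0 ≤ T) :
    Tendsto (fun N => coherentSum h N T) atTop (𝓝 (U T vacuum)) := by
  have hd : ∀ (ψ : finiteParticle) (t : ℝ),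
      HasDerivAt (fun s => U (-s) (ψ : FockSpace)) (-U (-t) (segalEnd h ψ : FockSpace)) t := by
    intro ψ t
    obtain ⟨hψ, e⟩ := hA ψ
    rw [← e]
    exact hU.hasDerivAt_neg ⟨ψ, hψ⟩ t
  have hder : ∀ (N : ℕ) (t : ℝ), HasDerivAt (fun s => U (-s) (coherentSum h N s))
      (U (-t) ((-(t * (‖h‖ : ℂ) ^ 2 / 2) * coherentCoeff (‖h‖ ^ 2) N t) •
          (coherentTerm h N : FockSpace) +
        ((Real.sqrt 2 : ℂ)⁻¹ * coherentCoeff (‖h‖ ^ 2) N t * ((N : ℂ) + 1)) •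
        (coherentTerm h (N + 1) : FockSpace))) t := by
    intro N t
    rw [← sum_coherent_error, map_sum]
    have h1 : (fun s => U (-s) (coherentSum h N s)) = fun s => ∑ n ∈ range (N + 1),
        (coherentCoeff (‖h‖ ^ 2) n s : ℂ) • U (-s) (coherentTerm h n : FockSpace) := by
      funext s
      rw [coherentSum, map_sum]
      simp only [map_smul]
    rw [h1]
    refine HasDerivAt.fun_sum fun n _ => ?_
    refine ((hasDerivAt_coherentCoeff (‖h‖ ^ 2) n t).ofReal_comp.smul
      (hd (coherentTerm h n) t)).congr_deriv ?_
    rw [map_sub, map_smul, map_smul, smul_neg]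
    abel
  rw [tendsto_iff_norm_sub_tendsto_zero]
  have hlim : Tendsto (fun N : ℕ => ((T * ‖h‖ ^ 2 / 2) *
      (((T + 1) * ‖h‖) ^ N / Real.sqrt N.factorial) +
      (2 * (T + 1) * ‖h‖) ^ (N + 1) / Real.sqrt (N + 1).factorial) * (T - 0)) atTop (𝓝 0) := by
    have := ((((tendsto_pow_div_sqrt_factorial ((T + 1) * ‖h‖)).const_mul (T * ‖h‖ ^ 2 / 2)).add
      ((tendsto_add_atTop_iff_nat 1).2
        (tendsto_pow_div_sqrt_factorial (2 * (T + 1) * ‖h‖)))).mul_const (T - 0))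
    simpa using this
  refine squeeze_zero (fun _ => norm_nonneg _) (fun N => ?_) hlim
  have hb := norm_image_sub_le_of_norm_deriv_le_segment' (a := 0) (b := T)
    (fun t _ => (hder N t).hasDerivWithinAt) (fun t ht => by
      rw [LinearIsometryEquiv.norm_map]
      exact norm_coherent_error_le h ht.1 ht.2.le N) T ⟨hT, le_rfl⟩
  rw [neg_zero, hU.zero_apply, coherentSum_zero] at hb
  rwa [← (U (-T)).norm_map, map_sub, hU.neg_apply]

/-- Evaluation at level `n` is continuous, and the truncations are constant there as soon as `N ≥
n`. -/
theorem unitaryGroup_vacuum_apply (hU : IsUnitaryGroupOf A U)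
    (hA : ∀ ψ : finiteParticle, ∃ hψ : (ψ : FockSpace) ∈ A.domain,
      Complex.I • A ⟨ψ, hψ⟩ = segalEnd h ψ) {T : ℝ} (hT : 0 ≤ T) (n : ℕ) :
    U T vacuum n =
      ((coherentCoeff (‖h‖ ^ 2) n T : ℂ) * (Real.sqrt n.factorial : ℂ)⁻¹) • tensorPow h n := by
  have h1 : Tendsto (fun N => coherentSum h N T n) atTop (𝓝 (U T vacuum n)) :=
    ((lp.lipschitzWith_one_eval (E := fun n : ℕ => nParticle n) 2 n).continuous.tendsto _).comp
      (tendsto_coherentSum h hU hA hT)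
  refine tendsto_nhds_unique h1 (tendsto_const_nhds.congr' ?_)
  filter_upwards [eventually_ge_atTop n] with N hN
  exact (coherentSum_apply h hN T).symm

end Coherent

/-! ### The energy of a coherent state -/

section Product

variable {p w : ℝ → ℝ≥0∞}

theorem lintegral_prod_pow (hp : Measurable p) (n : ℕ) :
    ∫⁻ k : Fin n → ℝ, ∏ j, p (k j) = (∫⁻ x, p x) ^ n := by
  induction n with
  | zero => simp [volume_pi]
  | succ n ih =>
    have hm : Measurable fun k : Fin n → ℝ => ∏ j, p (k j) := by fun_prop
    have h := (measurePreserving_split n).lintegral_comp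
      (f := fun z : ℝ × (Fin n → ℝ) => p z.1 * ∏ j, p (z.2 j)) (by fun_prop)
    rw [lintegral_prod_mul hp.aemeasurable hm.aemeasurable, ih] at h
    rw [pow_succ', ← h]
    refine lintegral_congr fun k => ?_
    rw [Fin.prod_univ_succ]
    rfl

/-- By Tonelli each of the `n` summands weights one factor and leaves `n - 1` copies of `∫ p`. The
truncated exponent at `n = 0` is harmless because of the factor `n`. -/
theorem lintegral_sum_mul_prod (hp : Measurable p) (hw : Measurable w) (n : ℕ) :
    ∫⁻ k : Fin n → ℝ, (∑ j, w (k j)) * ∏ j, p (k j) =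
      n * (∫⁻ x, p x) ^ (n - 1) * ∫⁻ x, w x * p x := by
  induction n with
  | zero => simp
  | succ n ih =>
    have hm : Measurable fun k : Fin n → ℝ => ∏ j, p (k j) := by fun_prop
    have hm' : Measurable fun k : Fin n → ℝ => (∑ j, w (k j)) * ∏ j, p (k j) := by fun_prop
    have hwp : Measurable fun x => w x * p x := hw.mul hp
    have h := (measurePreserving_split n).lintegral_comp
      (f := fun z : ℝ × (Fin n → ℝ) => w z.1 * p z.1 * ∏ j, p (z.2 j) +
        p z.1 * ((∑ j, w (z.2 j)) * ∏ j, p (z.2 j))) (by fun_prop)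
    have e : ∫⁻ k : Fin (n + 1) → ℝ, (∑ j, w (k j)) * ∏ j, p (k j) =
        ∫⁻ k : Fin (n + 1) → ℝ, (w (k 0) * p (k 0) * ∏ j, p (Fin.tail k j) +
          p (k 0) * ((∑ j, w (Fin.tail k j)) * ∏ j, p (Fin.tail k j))) := by
      refine lintegral_congr fun k => ?_
      rw [Fin.prod_univ_succ, Fin.sum_univ_succ]
      simp only [Fin.tail]
      ring
    rw [e]
    refine h.trans ?_
    rw [lintegral_add_left (by fun_prop), lintegral_prod_mul hwp.aemeasurable hm.aemeasurable,
      lintegral_prod_mul hp.aemeasurable hm'.aemeasurable, ih, lintegral_prod_pow hp,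
      Nat.add_sub_cancel]
    rcases n with _ | n
    · simp
    · rw [Nat.add_sub_cancel]
      push_cast
      ring

end Product

/-! ### Poisson statistics of the particle number -/

section Energy

variable (h : Lp ℂ 2 (volume : Measure ℝ))

theorem ofReal_norm_sq : ENNReal.ofReal (‖h‖ ^ 2) = ∫⁻ x, ‖h x‖ₑ ^ 2 := by
  have h1 := norm_sq_eq (Lp.memLp h)
  rw [← Lp.norm_def] at h1
  rw [h1, ofReal_integral_eq_lintegral_ofReal
    ((memLp_two_iff_integrable_sq_norm (Lp.memLp h).1).1 (Lp.memLp h))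
    (Eventually.of_forall fun x => sq_nonneg _)]
  refine lintegral_congr fun x => ?_
  rw [ENNReal.ofReal_pow (norm_nonneg _), ofReal_norm]

theorem omega_nonneg (m k : ℝ) : 0 ≤ omega m k := Real.sqrt_nonneg _

@[fun_prop]
theorem measurable_omega (m : ℝ) : Measurable (omega m) := by
  unfold omega
  fun_prop

theorem lintegral_energy_tensorPow (m : ℝ) (n : ℕ) (c : ℂ) :
    ∫⁻ k : Fin n → ℝ, ENNReal.ofReal (∑ j, omega m (k j)) *
        ‖((c • tensorPow h n : nParticle n) : L2n n) k‖ₑ ^ 2 =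
      ‖c‖ₑ ^ 2 * (n * ENNReal.ofReal (‖h‖ ^ 2) ^ (n - 1) *
        ∫⁻ x, ENNReal.ofReal (omega m x) * ‖h x‖ₑ ^ 2) := by
  have hmeas : Measurable fun x => ‖h x‖ₑ ^ 2 := (Lp.stronglyMeasurable h).enorm.pow_const 2
  have hw : Measurable fun x => ENNReal.ofReal (omega m x) :=
    (measurable_omega m).ennreal_ofReal
  rw [ofReal_norm_sq, ← lintegral_sum_mul_prod hmeas hw n,
    ← lintegral_const_mul _ (by fun_prop)]
  have hprod : ∀ k : Fin n → ℝ, ‖∏ j, h (k j)‖ₑ ^ 2 = ∏ j, ‖h (k j)‖ₑ ^ 2 := fun k => by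
    simp only [enorm, nnnorm_prod, ENNReal.ofNNReal_finsetProd, Finset.prod_pow]
  refine lintegral_congr_ae ?_
  filter_upwards [Lp.coeFn_smul c (tensorPowL2 h n), coeFn_tensorPowL2 h n] with k h1 h2
  change _ * ‖(c • tensorPowL2 h n : L2n n) k‖ₑ ^ 2 = _
  rw [h1, Pi.smul_apply, h2, enorm_smul, mul_pow, hprod,
    ENNReal.ofReal_sum_of_nonneg fun j _ => omega_nonneg m _]
  ring

theorem hasSum_real_exp (y : ℝ) :
    HasSum (fun n : ℕ => y ^ n / (n.factorial : ℝ)) (Real.exp y) := by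
  rw [Real.exp_eq_exp_ℝ]
  exact NormedSpace.expSeries_div_hasSum_exp y

/-- The numbers `coherentCoeff a n t ^ 2 * aⁿ / n!` are Poisson weights of mean `t²a/2`, and the sum
is that mean times `E / a`. Keeping the power `n - 1` avoids the division, so `a = 0` is covered. -/
theorem hasSum_coherentCoeff_sq (a t E : ℝ) :
    HasSum (fun n : ℕ => coherentCoeff a n t ^ 2 / n.factorial *
    (n * a ^ (n - 1) * E)) (t ^ 2 / 2 * E) := by
  refine (hasSum_nat_add_iff' (f := fun n : ℕ => coherentCoeff a n t ^ 2 / n.factorial *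
    (n * a ^ (n - 1) * E)) 1).1 ?_
  have h1 := (hasSum_real_exp (t ^ 2 / 2 * a)).mul_left
    (Real.exp (-(t ^ 2 / 2 * a)) * (t ^ 2 / 2 * E))
  rw [mul_right_comm, ← Real.exp_add, neg_add_cancel, Real.exp_zero,
    one_mul] at h1
  simp only [Finset.sum_range_one, Nat.cast_zero, zero_mul, mul_zero, sub_zero]
  refine h1.congr_fun fun n => ?_
  have hs : (Real.sqrt 2)⁻¹ ^ 2 = 1 / 2 := by
    rw [inv_pow, Real.sq_sqrt zero_le_two, one_div]
  have he : Real.exp (-(t ^ 2 * a / 4)) ^ 2 = Real.exp (-(t ^ 2 / 2 * a)) := by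
    rw [← Real.exp_nat_mul]
    congr 1
    push_cast
    ring
  have hc : coherentCoeff a (n + 1) t ^ 2 =
      Real.exp (-(t ^ 2 / 2 * a)) * (t ^ 2 / 2) ^ (n + 1) := by
    rw [coherentCoeff, mul_pow, he, ← pow_mul, mul_comm (n + 1), pow_mul, neg_sq, mul_pow, hs]
    congr 2
    ring
  rw [hc, Nat.factorial_succ, Nat.add_sub_cancel, mul_pow]
  push_cast
  have hf : (n.factorial : ℝ) ≠ 0 := by positivity
  have hn : (n : ℝ) + 1 ≠ 0 := by positivity
  field_simp
  ring

theorem energyForm_coherent {m a t E : ℝ} (ha : a = ‖h‖ ^ 2) (hE0 : 0 ≤ E)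
    (hE : ∫⁻ x, ENNReal.ofReal (omega m x) * ‖h x‖ₑ ^ 2 = ENNReal.ofReal E) {ψ : FockSpace}
    (hψ : ∀ n, ψ n = ((coherentCoeff a n t : ℂ) * (Real.sqrt n.factorial : ℂ)⁻¹) •
      tensorPow h n) :
    energyForm m ψ = ENNReal.ofReal (t ^ 2 / 2 * E) := by
  have ha0 : 0 ≤ a := ha ▸ sq_nonneg _
  have hterm : ∀ n : ℕ, ∫⁻ k : Fin n → ℝ, ENNReal.ofReal (∑ j, omega m (k j)) *
      ‖((ψ n : L2n n) : (Fin n → ℝ) → ℂ) k‖ₑ ^ 2 =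
      ENNReal.ofReal (coherentCoeff a n t ^ 2 / n.factorial * (n * a ^ (n - 1) * E)) := by
    intro n
    rw [hψ n, lintegral_energy_tensorPow, hE, ← ha,
      ENNReal.ofReal_mul (by positivity), ENNReal.ofReal_mul (by positivity),
      ENNReal.ofReal_mul (by positivity), ENNReal.ofReal_natCast, ENNReal.ofReal_pow ha0]
    congr 1
    rw [← ofReal_norm, ← ENNReal.ofReal_pow (norm_nonneg _), norm_mul, norm_inv,
      Complex.norm_real, Complex.norm_real, mul_pow, inv_pow, Real.norm_eq_abs, Real.norm_eq_abs,
      sq_abs, sq_abs, Real.sq_sqrt (by positivity), div_eq_mul_inv]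
  have hsum := hasSum_coherentCoeff_sq a t E
  rw [energyForm, ← hsum.tsum_eq, ENNReal.ofReal_tsum_of_nonneg (fun n => by positivity)
    hsum.summable]
  exact tsum_congr hterm

end Energy

/-! ### The one-particle energy of the profile, and its lower bound -/

section Momentum

/-- The Schwartz function `g`, regarded as complex valued. -/
def toComplex (g : 𝓢(ℝ, ℝ)) : 𝓢(ℝ, ℂ) := g.postcompCLM Complex.ofRealCLM

/-- The energy `ω` and the squared factor `ω^{1/2}` multiply to the polynomial `k² + m²`. The
argument `k/(2π)` translates the unitary transform into the convention of `𝓕`. -/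
theorem norm_sq_momentumFun (m : ℝ) (g : 𝓢(ℝ, ℝ)) (k : ℝ) :
    omega m k * ‖momentumFun m g k‖ ^ 2 =
      (k ^ 2 + m ^ 2) * ((2 * Real.pi)⁻¹ *
        ‖(𝓕 (toComplex g) : 𝓢(ℝ, ℂ)) (k * (2 * Real.pi)⁻¹)‖ ^ 2) := by
  have hint : ∫ x : ℝ, Complex.exp (-(Complex.I * k * x)) * (g x : ℂ) =
      (𝓕 (toComplex g) : 𝓢(ℝ, ℂ)) (k * (2 * Real.pi)⁻¹) := by
    rw [SchwartzMap.fourier_coe, Real.fourier_eq']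
    refine integral_congr_ae (Eventually.of_forall fun x => ?_)
    have hpi : (Real.pi : ℂ) ≠ 0 := by exact_mod_cast Real.pi_ne_zero
    have e : ((-2 * Real.pi * inner ℝ x (k * (2 * Real.pi)⁻¹) : ℝ) : ℂ) * Complex.I =
        -(Complex.I * k * x) := by
      simp only [RCLike.inner_apply, conj_trivial]
      push_cast
      field_simp
    simp only [smul_eq_mul]
    rw [e]
    rfl
  have hω : omega m k * omega m k = k ^ 2 + m ^ 2 := Real.mul_self_sqrt (by positivity)
  rw [momentumFun, hint, norm_mul, norm_mul, norm_inv, Complex.norm_real, Complex.norm_real,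
    mul_pow, mul_pow, inv_pow, Real.norm_eq_abs, Real.norm_eq_abs, sq_abs, sq_abs,
    Real.sq_sqrt (omega_nonneg m k), Real.sq_sqrt (by positivity), ← mul_assoc, hω]

theorem integrable_momentum_energy (m : ℝ) (g : 𝓢(ℝ, ℝ)) :
    Integrable fun k => omega m k * ‖momentumFun m g k‖ ^ 2 := by
  let L : ℝ ≃L[ℝ] ℝ :=
    ContinuousLinearEquiv.unitsEquivAut ℝ (Units.mk0 (2 * Real.pi)⁻¹ (by positivity))
  let s : 𝓢(ℝ, ℂ) := SchwartzMap.compCLMOfContinuousLinearEquiv ℂ L (𝓕 (toComplex g))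
  have hs : ∀ k, (𝓕 (toComplex g) : 𝓢(ℝ, ℂ)) (k * (2 * Real.pi)⁻¹) = s k := fun k => rfl
  have hq : Function.HasTemperateGrowth (fun k : ℝ => 1 + m ^ 2 + k ^ 2) := by
    fun_prop
  -- The added `1` makes the weight's square dominate `k² + m²`; the product is Schwartz, hence
  -- square integrable.
  let q : 𝓢(ℝ, ℂ) := SchwartzMap.smulLeftCLM ℂ (fun k : ℝ => 1 + m ^ 2 + k ^ 2) s
  have hint := ((memLp_two_iff_integrable_sq_norm (q.memLp 2 volume).1).1
    (q.memLp 2 volume)).const_mul (2 * Real.pi)⁻¹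
  have hfun : (fun k => omega m k * ‖momentumFun m g k‖ ^ 2) =
      fun k => (k ^ 2 + m ^ 2) * ((2 * Real.pi)⁻¹ * ‖s k‖ ^ 2) := by
    funext k
    rw [norm_sq_momentumFun, hs]
  rw [hfun]
  have hcont := s.continuous
  refine hint.mono' (by fun_prop) (Eventually.of_forall fun k => ?_)
  have hqk : q k = (1 + m ^ 2 + k ^ 2 : ℝ) • s k := SchwartzMap.smulLeftCLM_apply_apply hq s k
  rw [Real.norm_of_nonneg (by positivity), hqk, norm_smul, Real.norm_of_nonneg (by positivity),
    mul_pow]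
  have h1 : k ^ 2 + m ^ 2 ≤ (1 + m ^ 2 + k ^ 2) ^ 2 := by
    nlinarith [sq_nonneg k, sq_nonneg m, sq_nonneg (m ^ 2 + k ^ 2)]
  calc _ ≤ (1 + m ^ 2 + k ^ 2) ^ 2 * ((2 * Real.pi)⁻¹ * ‖s k‖ ^ 2) := by gcongr
    _ = _ := by ring

/-- Plancherel identifies the mass part of `∫ (k² + m²)|ĝ|²` with the left side; the discarded part
`k²|ĝ|²` is the gradient energy, which is nonnegative. -/
theorem mass_sq_mul_integral_le (m : ℝ) (g : 𝓢(ℝ, ℝ)) :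
    m ^ 2 * ∫ x, g x ^ 2 ≤ ∫ k, omega m k * ‖momentumFun m g k‖ ^ 2 := by
  have hpl : ∫ x, g x ^ 2 = ∫ k, (2 * Real.pi)⁻¹ *
      ‖(𝓕 (toComplex g) : 𝓢(ℝ, ℂ)) (k * (2 * Real.pi)⁻¹)‖ ^ 2 := by
    have h1 := SchwartzMap.integral_norm_sq_fourier (toComplex g)
    have h2 := Measure.integral_comp_mul_right
      (fun k => ‖(𝓕 (toComplex g) : 𝓢(ℝ, ℂ)) k‖ ^ 2) (2 * Real.pi)⁻¹
    rw [integral_const_mul, h2, inv_inv, abs_of_pos (by positivity), smul_eq_mul, ← mul_assoc,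
      inv_mul_cancel₀ (by positivity), one_mul, h1]
    refine integral_congr_ae (Eventually.of_forall fun x => ?_)
    change g x ^ 2 = ‖(g x : ℂ)‖ ^ 2
    rw [Complex.norm_real, Real.norm_eq_abs, sq_abs]
  rw [hpl, ← integral_const_mul]
  refine integral_mono_of_nonneg (Eventually.of_forall fun k => by positivity)
    (integrable_momentum_energy m g) (Eventually.of_forall fun k => ?_)
  change _ ≤ omega m k * ‖momentumFun m g k‖ ^ 2
  rw [norm_sq_momentumFun]
  exact mul_le_mul_of_nonneg_right (le_add_of_nonneg_left (sq_nonneg k)) (by positivity)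

theorem length_le_integral_sq {R ε : ℝ} (hR : 0 < R) {g : 𝓢(ℝ, ℝ)} (hg : IsStringProfile R ε g) :
    R ≤ ∫ x, g x ^ 2 := by
  have hint : Integrable fun x => g x ^ 2 := (g.memLp 2 volume).integrable_sq
  have h1 : ∫ x in Set.Icc 0 R, g x ^ 2 = R := by
    rw [setIntegral_congr_fun (g := fun _ => (1 : ℝ)) measurableSet_Icc fun x hx => by
      simp [hg.1 x hx.1 hx.2]]
    simp [hR.le]
  exact h1.symm.le.trans
    (setIntegral_le_integral hint (Eventually.of_forall fun x => sq_nonneg _))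

/-- The dipole state is the coherent state at time `t = √π`, so `t²/2 = π/2`. -/
theorem energyForm_dipoleState (e : ℝ) (g : 𝓢(ℝ, ℝ)) :
    energyForm (photonMass e) (dipoleState e g) = ENNReal.ofReal (Real.pi / 2 *
      ∫ k, omega (photonMass e) k * ‖momentumFun (photonMass e) g k‖ ^ 2) := by
  set m := photonMass e
  set h := (memLp_momentumFun m g).toLp (momentumFun m g)
  have hE : ∫⁻ x, ENNReal.ofReal (omega m x) * ‖h x‖ₑ ^ 2 =
      ENNReal.ofReal (∫ k, omega m k * ‖momentumFun m g k‖ ^ 2) := by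
    rw [ofReal_integral_eq_lintegral_ofReal (integrable_momentum_energy m g)
      (Eventually.of_forall fun k => mul_nonneg (omega_nonneg m k) (sq_nonneg _))]
    refine lintegral_congr_ae ?_
    filter_upwards [(memLp_momentumFun m g).coeFn_toLp] with k hk
    rw [hk, ENNReal.ofReal_mul (omega_nonneg m k), ENNReal.ofReal_pow (norm_nonneg _),
      ofReal_norm]
  have hA : ∀ ψ : finiteParticle, ∃ hψ : (ψ : FockSpace) ∈ (fieldMomentum m g).domain,
      Complex.I • fieldMomentum m g ⟨ψ, hψ⟩ = segalEnd h ψ := fun ψ =>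
    ⟨ψ.2, I_smul_fieldMomentum m g ψ⟩
  have hψ := unitaryGroup_vacuum_apply h (isUnitaryGroupOf_fieldMomentum m g) hA
    (Real.sqrt_nonneg Real.pi)
  change energyForm m (unitaryGroup (fieldMomentum m g) (Real.sqrt Real.pi) vacuum) = _
  rw [energyForm_coherent h rfl (integral_nonneg fun k =>
    mul_nonneg (omega_nonneg m k) (sq_nonneg _)) hE hψ, Real.sq_sqrt Real.pi_pos.le]

theorem inFormDomain_dipoleState (e : ℝ) (g : 𝓢(ℝ, ℝ)) :
    InFormDomain (photonMass e) (dipoleState e g) := by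
  rw [InFormDomain, energyForm_dipoleState]
  exact ENNReal.ofReal_lt_top

/-- The slope is `(π/2) m²` with `m² = e²/π`. Only the part of the profile over `[0, R]` is used, so
neither `ε` nor the shape of the edges enters. -/
theorem le_energy_dipoleState (e : ℝ) {R ε : ℝ} (hR : 0 < R) {g : 𝓢(ℝ, ℝ)}
    (hg : IsStringProfile R ε g) :
    e ^ 2 / 2 * R ≤ energy (photonMass e) (dipoleState e g) := by
  have h1 := mass_sq_mul_integral_le (photonMass e) g
  have h2 := length_le_integral_sq hR hg
  have h3 : photonMass e ^ 2 = e ^ 2 / Real.pi := by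
    rw [photonMass, div_pow, Real.sq_sqrt Real.pi_pos.le]
  rw [energy, energyForm_dipoleState, ENNReal.toReal_ofReal (mul_nonneg (by positivity)
    (integral_nonneg fun k => mul_nonneg (omega_nonneg _ k) (sq_nonneg _)))]
  have hpi := Real.pi_pos
  calc e ^ 2 / 2 * R = Real.pi / 2 * (photonMass e ^ 2 * R) := by
        rw [h3]
        field_simp
    _ ≤ Real.pi / 2 * (photonMass e ^ 2 * ∫ x, g x ^ 2) := by gcongr
    _ ≤ _ := by gcongr

theorem limsup_eq_top_of_linear_le {c : ℝ} (hc : 0 < c) {f : ℝ → ℝ}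
    (hf : ∀ R, 0 < R → c * R ≤ f R) :
    limsup (fun R => (f R : EReal)) atTop = ⊤ := by
  have h1 : Tendsto f atTop atTop :=
    tendsto_atTop_mono' _ ((eventually_gt_atTop 0).mono hf)
      (Tendsto.const_mul_atTop hc tendsto_id)
  exact (EReal.tendsto_coe_nhds_top_iff.2 h1).limsup_eq

end Momentum

end Schwinger

end

/-! ### Linear growth of the energy and confinement -/

theorem corollary5p3 (e : ℝ) (he : e ≠ 0) :
    ∃ c : ℝ, 0 < c ∧ ∀ ε : ℝ, 0 < ε → ∀ g : ℝ → SchwartzMap ℝ ℝ,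
      (∀ R : ℝ, 0 < R → Schwinger.IsStringProfile R ε (g R)) →
        (∀ R : ℝ, 0 < R →
          Schwinger.InFormDomain (Schwinger.photonMass e) (Schwinger.dipoleState e (g R)) ∧
          c * R ≤ Schwinger.energy (Schwinger.photonMass e) (Schwinger.dipoleState e (g R))) ∧
        Filter.limsup (fun R : ℝ =>
          (Schwinger.energy (Schwinger.photonMass e) (Schwinger.dipoleState e (g R)) : EReal))
          Filter.atTop = ⊤ ∧
        Schwinger.FermionsConfined (Schwinger.photonMass e)
          (fun R : ℝ => Schwinger.dipoleState e (g R)) := by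
  have hc : 0 < e ^ 2 / 2 := by positivity
  refine ⟨e ^ 2 / 2, hc, fun ε _ g hg => ?_⟩
  have hdom := fun R => Schwinger.inFormDomain_dipoleState e (g R)
  have hle := fun R (hR : 0 < R) => Schwinger.le_energy_dipoleState e hR (hg R hR)
  have hlim := Schwinger.limsup_eq_top_of_linear_le hc hle
  exact ⟨fun R hR => ⟨hdom R, hle R hR⟩, hlim, fun R _ => hdom R,
    fun hfin => hfin.2.ne hlim, hlim⟩
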